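/- A *symmetric strict monoidal category* is a symmetric monoidal category whose tensor product is strictly associative and unital (associators and unitors are identities). A *strict symmetric monoidal functor* between two such categories is a functor that preserves the unit object, the tensor product of objects and of morphisms, and the symmetry $P$ on the nose. A *commutative Hopf monoid* in such a category $(\mathcal C,\otimes,I,P)$ is an object $A$ with morphisms $\mu:A\otimes A\to A$, $\eta:I\to A$, $\Delta:A\to A\otimes A$, $\epsilon:A\to I$, $S:A\to A$ such that $(A,\mu,\eta)$ is a monoid, $(A,\Delta,\epsilon)$ is a comonoid, $\epsilon\eta=1_I$, $\epsilon\mu=\epsilon\otimes\epsilon$, $\Delta\eta=\eta\otimes\eta$, $\Delta\mu=(\mu\otimes\mu)(1_A\otimes P_{A,A}\otimes 1_A)(\Delta\otimes\Delta)$, $\mu(1_A\otimes S)\Delta=\mu(S\otimes 1_A)\Delta=\eta\epsilon$ and $\mu P_{A,A}=\mu$. Let $\mathbf H$ be the free symmetric strict monoidal category generated by a commutative Hopf monoid $\mathsf H$: its objects are the tensor powers $\mathsf H^{\otimes n}$, $n\ge 0$, identified with $n$, and its morphisms are the formal composites and tensor products of identities, symmetries $P_{m,n}:m+n\to n+m$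 and generators $\mu:2\to1$, $\eta:0\to1$, $\Delta:1\to2$, $\epsilon:1\to0$, $S:1\to1$, modulo exactly the relations implied by the axioms of a symmetric strict monoidal category and of a commutative Hopf monoid. Let $\mathbf F$ be the full subcategory of the category of groups on the free groups $F_n=\langle x_1,\dots,x_n\rangle$, $n\ge 0$, with $F_n$ identified with $n$. It is a symmetric strict monoidal category: the tensor product is the free product, with $F_m * F_n$ identified with $F_{m+n}$ (the generators of $F_m$ becoming $x_1,\dots,x_m$ and those of $F_n$ becoming $x_{m+1},\dots,x_{m+n}$), the unit object is $F_0$, and the symmetry $P_{m,n}:F_{m+n}\to F_{n+m}$ interchanges the two factors, that is, $x_i\mapsto x_{n+i}$ for $1\le i\le m$ and $x_{m+j}\mapsto x_j$ for $1\le j\le n$. The object $F_1\cong\mathbb Z$ is a commutative Hopf monoid $\mathsf F$ in $\mathbf F$ with $$\mu:\ x_1,x_2\mapsto x_1,\qquad \eta:F_0\to F_1,\qquad \Delta:\ x_1\mapsto x_1x_2,\qquad \epsilon:\ x_1\mapsto 1,\qquad S:\ x_1\mapsto x_1^{-1}.$$ **Theorem.** There is a unique strict symmetric monoidal functor $T:\mathbf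 H\to\mathbf F$ that maps the Hopf monoid $\mathsf H$ to the Hopf monoid $\mathsf F$ (the object and each of the five structure morphisms), and $T$ is an isomorphism of symmetric strict monoidal categories: there is a strict symmetric monoidal functor $G:\mathbf F\to\mathbf H$ with $GT=1_{\mathbf H}$ and $TG=1_{\mathbf F}$. -/

import Mathlib

open CategoryTheory MonoidalCategory

/-! ### Symmetric strict monoidal categories and the functors between them -/

/-- A monoidal category is strict when the tensor product is associative and unital on the nose and
the structural isomorphisms are identities. -/
class StrictMonoidal (C : Type*) [Category C] [MonoidalCategory C] : Prop where
  tensor_assoc (X Y Z : C) : (X ⊗ Y) ⊗ Z = X ⊗ (Y ⊗ Z)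
  unit_tensor (X : C) : 𝟙_ C ⊗ X = X
  tensor_unit (X : C) : X ⊗ 𝟙_ C = X
  associator_hom (X Y Z : C) : (α_ X Y Z).hom = eqToHom (tensor_assoc X Y Z)
  leftUnitor_hom (X : C) : (λ_ X).hom = eqToHom (unit_tensor X)
  rightUnitor_hom (X : C) : (ρ_ X).hom = eqToHom (tensor_unit X)

/-- A strict symmetric monoidal functor between symmetric strict monoidal categories: a functor that
preserves the unit object, the tensor product of objects and of morphisms, and the symmetry. As the
associators and unitors are identities, they are preserved automatically. -/
structure StrictSymmetricFunctor (C D : Type*)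
    [Category C] [MonoidalCategory C] [SymmetricCategory C] [StrictMonoidal C]
    [Category D] [MonoidalCategory D] [SymmetricCategory D] [StrictMonoidal D]
    extends C ⥤ D where
  obj_unit : obj (𝟙_ C) = 𝟙_ D
  obj_tensor (X Y : C) : obj (X ⊗ Y) = obj X ⊗ obj Y
  map_tensor {X Y X' Y' : C} (f : X ⟶ Y) (g : X' ⟶ Y') :
    map (f ⊗ₘ g) =
      eqToHom (obj_tensor X X') ≫ (map f ⊗ₘ map g) ≫ eqToHom (obj_tensor Y Y').symm
  map_symmetry (X Y : C) :
    map (β_ X Y).hom =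
      eqToHom (obj_tensor X Y) ≫ (β_ (obj X) (obj Y)).hom ≫ eqToHom (obj_tensor Y X).symm

namespace StrictSymmetricFunctor

variable {C D : Type*}
    [Category C] [MonoidalCategory C] [SymmetricCategory C] [StrictMonoidal C]
    [Category D] [MonoidalCategory D] [SymmetricCategory D] [StrictMonoidal D]

theorem obj_tensor_self (T : StrictSymmetricFunctor C D) {A : C} {B : D} (h : T.obj A = B) :
    T.obj (A ⊗ A) = B ⊗ B := by
  rw [T.obj_tensor, h]

open scoped MonObj ComonObj HopfObj in
/-- `T` maps the Hopf monoid `A` to the Hopf monoid `B`: it sends the object to the object and each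
of the five structure morphisms to the corresponding structure morphism. -/
structure MapsHopf (T : StrictSymmetricFunctor C D) (A : C) (B : D) [HopfObj A] [HopfObj B] :
    Prop where
  obj_eq : T.obj A = B
  map_mul : T.map μ[A] = eqToHom (T.obj_tensor_self obj_eq) ≫ μ[B] ≫ eqToHom obj_eq.symm
  map_one : T.map η[A] = eqToHom T.obj_unit ≫ η[B] ≫ eqToHom obj_eq.symm
  map_comul : T.map Δ[A] = eqToHom obj_eq ≫ Δ[B] ≫ eqToHom (T.obj_tensor_self obj_eq).symm
  map_counit : T.map ε[A] = eqToHom obj_eq ≫ ε[B] ≫ eqToHom T.obj_unit.symm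
  map_antipode : T.map 𝒮[A] = eqToHom obj_eq ≫ 𝒮[B] ≫ eqToHom obj_eq.symm

/-- `T` is an isomorphism of symmetric strict monoidal categories: it has a two-sided inverse (an
equality of functors, not only a natural isomorphism) that is a strict symmetric monoidal functor. -/
def IsIsomorphism (T : StrictSymmetricFunctor C D) : Prop :=
  ∃ G : StrictSymmetricFunctor D C,
    T.toFunctor ⋙ G.toFunctor = 𝟭 C ∧ G.toFunctor ⋙ T.toFunctor = 𝟭 D

end StrictSymmetricFunctor

/-! ### Symmetric strict monoidal categories with objects the natural numbers -/

/-- The operations of a symmetric strict monoidal category with set of objects `ℕ`, unit object `0`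
and tensor product `m ⊗ n = m + n`. Composition is written in diagrammatic order. -/
structure PropData where
  Hom : ℕ → ℕ → Type
  id (n : ℕ) : Hom n n
  comp {l m n : ℕ} : Hom l m → Hom m n → Hom l n
  tensor {m n m' n' : ℕ} : Hom m n → Hom m' n' → Hom (m + m') (n + n')
  swap (m n : ℕ) : Hom (m + n) (n + m)

/-- The identity morphism, between two provably equal objects. -/
def PropData.eqId (P : PropData) {m n : ℕ} (h : m = n) : P.Hom m n := h ▸ P.id m

/-- A symmetric strict monoidal category with set of objects `ℕ`, unit object `0` and tensor product
`m ⊗ n = m + n`. -/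
structure StrictProp extends PropData where
  id_comp {m n : ℕ} (f : Hom m n) : comp (id m) f = f
  comp_id {m n : ℕ} (f : Hom m n) : comp f (id n) = f
  assoc {k l m n : ℕ} (f : Hom k l) (g : Hom l m) (h : Hom m n) :
    comp (comp f g) h = comp f (comp g h)
  tensor_id (m n : ℕ) : tensor (id m) (id n) = id (m + n)
  tensor_comp {l m n l' m' n' : ℕ} (f : Hom l m) (g : Hom m n) (f' : Hom l' m') (g' : Hom m' n') :
    tensor (comp f g) (comp f' g') = comp (tensor f f') (tensor g g')
  tensor_assoc {m n m' n' m'' n'' : ℕ} (f : Hom m n) (g : Hom m' n') (h : Hom m'' n'') :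
    comp (tensor (tensor f g) h) (toPropData.eqId (Nat.add_assoc n n' n'')) =
      comp (toPropData.eqId (Nat.add_assoc m m' m'')) (tensor f (tensor g h))
  unit_tensor {m n : ℕ} (f : Hom m n) :
    comp (tensor (id 0) f) (toPropData.eqId (Nat.zero_add n)) =
      comp (toPropData.eqId (Nat.zero_add m)) f
  tensor_unit {m n : ℕ} (f : Hom m n) :
    comp (tensor f (id 0)) (toPropData.eqId (Nat.add_zero n)) =
      comp (toPropData.eqId (Nat.add_zero m)) f
  swap_natural {m n m' n' : ℕ} (f : Hom m n) (g : Hom m' n') :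
    comp (tensor f g) (swap n n') = comp (swap m m') (tensor g f)
  swap_swap (m n : ℕ) : comp (swap m n) (swap n m) = id (m + n)
  hexagon (l m n : ℕ) :
    comp (toPropData.eqId (Nat.add_assoc l m n))
        (comp (swap l (m + n)) (toPropData.eqId (Nat.add_assoc m n l))) =
      comp (tensor (swap l m) (id n))
        (comp (toPropData.eqId (Nat.add_assoc m l n)) (tensor (id m) (swap l n)))

namespace StrictProp

/-- The objects of the category `P`: the natural numbers. -/
def Obj (_P : StrictProp) : Type := ℕ

variable (P : StrictProp)

instance : Category P.Obj where
  Hom m n := P.Hom m n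
  id n := P.id n
  comp f g := P.comp f g
  id_comp := P.id_comp
  comp_id := P.comp_id
  assoc := P.assoc

theorem eqId_eq {m n : ℕ} (h : m = n) : P.eqId h = @eqToHom P.Obj _ m n h := by
  subst h; rfl

instance : MonoidalCategoryStruct P.Obj where
  tensorObj m n := (Nat.add m n : ℕ)
  tensorUnit := (0 : ℕ)
  whiskerLeft m _ _ f := P.tensor (P.id m) f
  whiskerRight f n := P.tensor f (P.id n)
  tensorHom f g := P.tensor f g
  associator l m n := eqToIso (Nat.add_assoc l m n)
  leftUnitor n := eqToIso (Nat.zero_add n)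
  rightUnitor n := eqToIso (Nat.add_zero n)

theorem tensorHom_def' {m n m' n' : P.Obj} (f : m ⟶ n) (g : m' ⟶ n') :
    f ⊗ₘ g = P.tensor f g := rfl

theorem eqToHom_tensor {m n m' n' : P.Obj} (h : m = n) (h' : m' = n') :
    eqToHom h ⊗ₘ eqToHom h' = eqToHom (congrArg₂ (· ⊗ ·) h h') := by
  subst h; subst h'; exact P.tensor_id _ _

theorem tensor_assoc' {m n m' n' m'' n'' : ℕ}
    (f : P.Hom m n) (g : P.Hom m' n') (h : P.Hom m'' n'') :
    P.comp (P.tensor (P.tensor f g) h) (@eqToHom P.Obj _ _ _ (Nat.add_assoc n n' n'')) =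
      P.comp (@eqToHom P.Obj _ _ _ (Nat.add_assoc m m' m'')) (P.tensor f (P.tensor g h)) := by
  have := P.tensor_assoc f g h
  rwa [eqId_eq, eqId_eq] at this

theorem unit_tensor' {m n : ℕ} (f : P.Hom m n) :
    P.comp (P.tensor (P.id 0) f) (@eqToHom P.Obj _ _ _ (Nat.zero_add n)) =
      P.comp (@eqToHom P.Obj _ _ _ (Nat.zero_add m)) f := by
  have := P.unit_tensor f
  rwa [eqId_eq, eqId_eq] at this

theorem tensor_unit' {m n : ℕ} (f : P.Hom m n) :
    P.comp (P.tensor f (P.id 0)) (@eqToHom P.Obj _ _ _ (Nat.add_zero n)) =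
      P.comp (@eqToHom P.Obj _ _ _ (Nat.add_zero m)) f := by
  have := P.tensor_unit f
  rwa [eqId_eq, eqId_eq] at this

theorem hexagon' (l m n : ℕ) :
    P.comp (@eqToHom P.Obj _ _ _ (Nat.add_assoc l m n))
        (P.comp (P.swap l (m + n)) (@eqToHom P.Obj _ _ _ (Nat.add_assoc m n l))) =
      P.comp (P.tensor (P.swap l m) (P.id n))
        (P.comp (@eqToHom P.Obj _ _ _ (Nat.add_assoc m l n))
          (P.tensor (P.id m) (P.swap l n))) := by
  have := P.hexagon l m n
  rwa [eqId_eq, eqId_eq, eqId_eq] at this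

theorem associator_eq (X Y Z : P.Obj) :
    (α_ X Y Z).hom = eqToHom (show (X ⊗ Y) ⊗ Z = X ⊗ (Y ⊗ Z) from Nat.add_assoc X Y Z) := rfl

theorem leftUnitor_eq (X : P.Obj) :
    (λ_ X).hom = eqToHom (show 𝟙_ P.Obj ⊗ X = X from Nat.zero_add X) := rfl

theorem rightUnitor_eq (X : P.Obj) :
    (ρ_ X).hom = eqToHom (show X ⊗ 𝟙_ P.Obj = X from Nat.add_zero X) := rfl

theorem pentagon' (W X Y Z : P.Obj) :
    ((α_ W X Y).hom ⊗ₘ 𝟙 Z) ≫ (α_ W (X ⊗ Y) Z).hom ≫ (𝟙 W ⊗ₘ (α_ X Y Z).hom) =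
      (α_ (W ⊗ X) Y Z).hom ≫ (α_ W X (Y ⊗ Z)).hom := by
  rw [← eqToHom_refl Z rfl, ← eqToHom_refl W rfl]
  simp only [associator_eq, eqToHom_tensor, eqToHom_trans]

theorem triangle' (X Y : P.Obj) :
    (α_ X (𝟙_ P.Obj) Y).hom ≫ (𝟙 X ⊗ₘ (λ_ Y).hom) = (ρ_ X).hom ⊗ₘ 𝟙 Y := by
  rw [← eqToHom_refl X rfl, ← eqToHom_refl Y rfl]
  simp only [associator_eq, leftUnitor_eq, rightUnitor_eq, eqToHom_tensor, eqToHom_trans]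

instance : MonoidalCategory P.Obj :=
  MonoidalCategory.ofTensorHom
    (id_tensorHom_id := fun m n => P.tensor_id m n)
    (id_tensorHom := fun _ _ _ _ => rfl)
    (tensorHom_id := fun _ _ => rfl)
    (tensorHom_comp_tensorHom := fun f g f' g' => (P.tensor_comp f f' g g').symm)
    (associator_naturality := P.tensor_assoc')
    (leftUnitor_naturality := P.unit_tensor')
    (rightUnitor_naturality := P.tensor_unit')
    (pentagon := P.pentagon')
    (triangle := P.triangle')

instance : StrictMonoidal P.Obj where
  tensor_assoc := Nat.add_assoc
  unit_tensor := Nat.zero_add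
  tensor_unit := Nat.add_zero
  associator_hom _ _ _ := rfl
  leftUnitor_hom _ := rfl
  rightUnitor_hom _ := rfl

/-- The symmetry as an isomorphism. -/
def swapIso (m n : P.Obj) : m ⊗ n ≅ n ⊗ m where
  hom := P.swap m n
  inv := P.swap n m
  hom_inv_id := P.swap_swap m n
  inv_hom_id := P.swap_swap n m

theorem swapIso_hexagon (X Y Z : P.Obj) :
    (α_ X Y Z).hom ≫ (P.swapIso X (Y ⊗ Z)).hom ≫ (α_ Y Z X).hom =
      ((P.swapIso X Y).hom ▷ Z) ≫ (α_ Y X Z).hom ≫ (Y ◁ (P.swapIso X Z).hom) :=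
  P.hexagon' X Y Z

instance : SymmetricCategory P.Obj where
  braiding := P.swapIso
  braiding_naturality_right X _ _ f := P.swap_natural (P.id X) f
  braiding_naturality_left f Z := P.swap_natural f (P.id Z)
  hexagon_forward := P.swapIso_hexagon
  hexagon_reverse X Y Z := by
    have h : (α_ Z X Y).hom ≫ (P.swapIso Z (X ⊗ Y)).hom ≫ (α_ X Y Z).hom =
      ((P.swapIso Z X).hom ▷ Y) ≫ (α_ X Z Y).hom ≫ (X ◁ (P.swapIso Z Y).hom) := P.swapIso_hexagon Z X Y
    have h' : α_ Z X Y ≪≫ P.swapIso Z (X ⊗ Y) ≪≫ α_ X Y Z =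
      whiskerRightIso (P.swapIso Z X) Y ≪≫ α_ X Z Y ≪≫ whiskerLeftIso X (P.swapIso Z Y) :=
      Iso.ext h
    have h'' := congrArg Iso.inv h'
    simp only [Iso.trans_inv, whiskerRightIso_inv, whiskerLeftIso_inv, Category.assoc] at h''
    exact h''
  symmetry := P.swap_swap

/-- A commutative Hopf monoid structure on the object `1` of `P`. -/
structure CommHopfData where
  mul : P.Hom 2 1
  one : P.Hom 0 1
  comul : P.Hom 1 2
  counit : P.Hom 1 0
  antipode : P.Hom 1 1
  mul_assoc :
    P.comp (P.tensor mul (P.id 1)) mul = P.comp (P.tensor (m := 1) (n := 1) (P.id 1) mul) mul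
  one_mul : P.comp (P.tensor one (P.id 1)) mul = P.id 1
  mul_one : P.comp (P.tensor (P.id 1) one) mul = P.id 1
  comul_assoc :
    P.comp comul (P.tensor comul (P.id 1)) =
      P.comp comul (P.tensor (m := 1) (n := 1) (P.id 1) comul)
  counit_comul : P.comp comul (P.tensor counit (P.id 1)) = P.id 1
  comul_counit : P.comp comul (P.tensor (P.id 1) counit) = P.id 1
  one_counit : P.comp one counit = P.id 0
  mul_counit : P.comp mul counit = P.tensor counit counit
  one_comul : P.comp one comul = P.tensor one one
  mul_comul : P.comp mul comul =
    P.comp (P.tensor comul comul)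
      (P.comp (P.tensor (m := 1) (n := 1) (m' := 3) (n' := 3) (P.id 1)
          (P.tensor (m := 2) (n := 2) (P.swap 1 1) (P.id 1)))
        (P.tensor (m := 2) (m' := 2) mul mul))
  antipode_right : P.comp comul (P.comp (P.tensor (P.id 1) antipode) mul) = P.comp counit one
  antipode_left : P.comp comul (P.comp (P.tensor antipode (P.id 1)) mul) = P.comp counit one
  mul_comm : P.comp (P.swap 1 1) mul = mul

/-- The object `1` of `P`. -/
def gen : P.Obj := (1 : ℕ)

variable {P}

theorem tensorMu_gen : tensorμ P.gen P.gen P.gen P.gen =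
    P.tensor (m := 1) (n := 1) (m' := 3) (n' := 3) (P.id 1)
          (P.tensor (m := 2) (n := 2) (P.swap 1 1) (P.id 1)) := by
  have h : tensorμ P.gen P.gen P.gen P.gen = P.comp (P.id 4) (P.comp (P.tensor (P.id 1) (P.id 3))
      (P.comp (P.tensor (m := 1) (n := 1) (m' := 3) (n' := 3) (P.id 1)
          (P.tensor (m := 2) (n := 2) (P.swap 1 1) (P.id 1)))
      (P.comp (P.tensor (P.id 1) (P.id 3)) (P.id 4)))) := rfl
  rw [h, P.tensor_id, P.id_comp, P.comp_id]
  exact (P.id_comp _).trans (P.comp_id _)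

/-- A commutative Hopf monoid structure on the object `1`, seen as a Hopf monoid of Mathlib. -/
abbrev CommHopfData.hopfObj (H : P.CommHopfData) : HopfObj P.gen where
  mul := H.mul
  one := H.one
  comul := H.comul
  counit := H.counit
  antipode := H.antipode
  one_mul := H.one_mul
  mul_one := H.mul_one
  mul_assoc := H.mul_assoc.trans (P.id_comp _).symm
  counit_comul := H.counit_comul
  comul_counit := H.comul_counit
  comul_assoc := H.comul_assoc.symm.trans
    (congrArg (P.comp H.comul) (P.comp_id (P.tensor H.comul (P.id 1))).symm)
  mul_comul := by
    rw [tensorMu_gen]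
    exact H.mul_comul
  one_comul := H.one_comul.trans (P.id_comp _).symm
  mul_counit := H.mul_counit.trans (P.comp_id _).symm
  one_counit := H.one_counit
  antipode_left := H.antipode_left
  antipode_right := H.antipode_right

end StrictProp

/-! ### The free symmetric strict monoidal category generated by a commutative Hopf monoid -/

/-- Formal composites and tensor products of the symmetries and of the structure morphisms of a Hopf
monoid; `HopfTerm m n` consists of the terms `H^{⊗m} → H^{⊗n}`. Composition is written in
diagrammatic order. -/
inductive HopfTerm : ℕ → ℕ → Type
  | id (n : ℕ) : HopfTerm n n
  | comp {l m n : ℕ} : HopfTerm l m → HopfTerm m n → HopfTerm l n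
  | tensor {m n m' n' : ℕ} : HopfTerm m n → HopfTerm m' n' → HopfTerm (m + m') (n + n')
  | swap (m n : ℕ) : HopfTerm (m + n) (n + m)
  | mul : HopfTerm 2 1
  | one : HopfTerm 0 1
  | comul : HopfTerm 1 2
  | counit : HopfTerm 1 0
  | antipode : HopfTerm 1 1

namespace HopfTerm

/-- The identity term, between two provably equal objects. -/
def eqId {m n : ℕ} (h : m = n) : HopfTerm m n := h ▸ id m

/-- The least congruence on terms that contains the axioms of a symmetric strict monoidal category
and the axioms of a commutative Hopf monoid. -/
inductive Rel : ∀ {m n : ℕ}, HopfTerm m n → HopfTerm m n → Prop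
  -- equivalence relation
  | refl {m n : ℕ} (f : HopfTerm m n) : Rel f f
  | symm {m n : ℕ} {f g : HopfTerm m n} : Rel f g → Rel g f
  | trans {m n : ℕ} {f g h : HopfTerm m n} : Rel f g → Rel g h → Rel f h
  -- compatibility with composition and tensor product
  | comp_congr {l m n : ℕ} {f f' : HopfTerm l m} {g g' : HopfTerm m n} :
      Rel f f' → Rel g g' → Rel (comp f g) (comp f' g')
  | tensor_congr {m n m' n' : ℕ} {f f' : HopfTerm m n} {g g' : HopfTerm m' n'} :
      Rel f f' → Rel g g' → Rel (tensor f g) (tensor f' g')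
  -- category
  | id_comp {m n : ℕ} (f : HopfTerm m n) : Rel (comp (id m) f) f
  | comp_id {m n : ℕ} (f : HopfTerm m n) : Rel (comp f (id n)) f
  | assoc {k l m n : ℕ} (f : HopfTerm k l) (g : HopfTerm l m) (h : HopfTerm m n) :
      Rel (comp (comp f g) h) (comp f (comp g h))
  -- strict monoidal category
  | tensor_id (m n : ℕ) : Rel (tensor (id m) (id n)) (id (m + n))
  | tensor_comp {l m n l' m' n' : ℕ} (f : HopfTerm l m) (g : HopfTerm m n)
      (f' : HopfTerm l' m') (g' : HopfTerm m' n') :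
      Rel (tensor (comp f g) (comp f' g')) (comp (tensor f f') (tensor g g'))
  | tensor_assoc {m n m' n' m'' n'' : ℕ}
      (f : HopfTerm m n) (g : HopfTerm m' n') (h : HopfTerm m'' n'') :
      Rel (comp (tensor (tensor f g) h) (eqId (Nat.add_assoc n n' n'')))
        (comp (eqId (Nat.add_assoc m m' m'')) (tensor f (tensor g h)))
  | unit_tensor {m n : ℕ} (f : HopfTerm m n) :
      Rel (comp (tensor (id 0) f) (eqId (Nat.zero_add n))) (comp (eqId (Nat.zero_add m)) f)
  | tensor_unit {m n : ℕ} (f : HopfTerm m n) :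
      Rel (comp (tensor f (id 0)) (eqId (Nat.add_zero n))) (comp (eqId (Nat.add_zero m)) f)
  -- symmetry
  | swap_natural {m n m' n' : ℕ} (f : HopfTerm m n) (g : HopfTerm m' n') :
      Rel (comp (tensor f g) (swap n n')) (comp (swap m m') (tensor g f))
  | swap_swap (m n : ℕ) : Rel (comp (swap m n) (swap n m)) (id (m + n))
  | hexagon (l m n : ℕ) :
      Rel
        (comp (eqId (Nat.add_assoc l m n)) (comp (swap l (m + n)) (eqId (Nat.add_assoc m n l))))
        (comp (tensor (swap l m) (id n))
          (comp (eqId (Nat.add_assoc m l n)) (tensor (id m) (swap l n))))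
  -- monoid
  | mul_assoc :
      Rel (comp (tensor mul (id 1)) mul) (comp (tensor (m := 1) (n := 1) (id 1) mul) mul)
  | one_mul : Rel (comp (tensor one (id 1)) mul) (id 1)
  | mul_one : Rel (comp (tensor (id 1) one) mul) (id 1)
  -- comonoid
  | comul_assoc :
      Rel (comp comul (tensor comul (id 1))) (comp comul (tensor (m := 1) (n := 1) (id 1) comul))
  | counit_comul : Rel (comp comul (tensor counit (id 1))) (id 1)
  | comul_counit : Rel (comp comul (tensor (id 1) counit)) (id 1)
  -- bimonoid
  | one_counit : Rel (comp one counit) (id 0)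
  | mul_counit : Rel (comp mul counit) (tensor counit counit)
  | one_comul : Rel (comp one comul) (tensor one one)
  | mul_comul : Rel (comp mul comul)
      (comp (tensor comul comul)
        (comp (tensor (m := 1) (n := 1) (m' := 3) (n' := 3) (id 1)
            (tensor (m := 2) (n := 2) (swap 1 1) (id 1)))
          (tensor mul mul)))
  -- antipode
  | antipode_right : Rel (comp comul (comp (tensor (id 1) antipode) mul)) (comp counit one)
  | antipode_left : Rel (comp comul (comp (tensor antipode (id 1)) mul)) (comp counit one)
  -- commutativity
  | mul_comm : Rel (comp (swap 1 1) mul) mul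

instance setoid (m n : ℕ) : Setoid (HopfTerm m n) where
  r := Rel
  iseqv := ⟨Rel.refl, Rel.symm, Rel.trans⟩

end HopfTerm

/-- The operations on classes of terms. -/
def hopfPropData : PropData where
  Hom m n := Quotient (HopfTerm.setoid m n)
  id n := Quotient.mk _ (HopfTerm.id n)
  comp := Quotient.map₂ HopfTerm.comp fun _ _ h _ _ h' => HopfTerm.Rel.comp_congr h h'
  tensor := Quotient.map₂ HopfTerm.tensor fun _ _ h _ _ h' => HopfTerm.Rel.tensor_congr h h'
  swap m n := Quotient.mk _ (HopfTerm.swap m n)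

theorem hopfPropData_eqId {m n : ℕ} (h : m = n) :
    hopfPropData.eqId h = Quotient.mk (HopfTerm.setoid m n) (HopfTerm.eqId h) := by
  subst h; rfl

/-- The free symmetric strict monoidal category generated by a commutative Hopf monoid: its objects
are the tensor powers `n` of the generating object `1`, its morphisms are the classes of terms modulo
the axioms of a symmetric strict monoidal category and of a commutative Hopf monoid. -/
def hopfProp : StrictProp where
  toPropData := hopfPropData
  id_comp f := by
    induction f using Quotient.inductionOn with | h f => exact Quotient.sound (.id_comp f)
  comp_id f := by
    induction f using Quotient.inductionOn with | h f => exact Quotient.sound (.comp_id f)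
  assoc f g h := by
    induction f, g, h using Quotient.inductionOn₃ with
    | h f g h => exact Quotient.sound (.assoc f g h)
  tensor_id m n := Quotient.sound (.tensor_id m n)
  tensor_comp f g f' g' := by
    induction f, g using Quotient.inductionOn₂ with | h f g =>
    induction f', g' using Quotient.inductionOn₂ with | h f' g' =>
    exact Quotient.sound (.tensor_comp f g f' g')
  tensor_assoc f g h := by
    rw [hopfPropData_eqId, hopfPropData_eqId]
    induction f, g, h using Quotient.inductionOn₃ with
    | h f g h => exact Quotient.sound (.tensor_assoc f g h)
  unit_tensor f := by
    rw [hopfPropData_eqId, hopfPropData_eqId]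
    induction f using Quotient.inductionOn with | h f => exact Quotient.sound (.unit_tensor f)
  tensor_unit f := by
    rw [hopfPropData_eqId, hopfPropData_eqId]
    induction f using Quotient.inductionOn with | h f => exact Quotient.sound (.tensor_unit f)
  swap_natural f g := by
    induction f, g using Quotient.inductionOn₂ with
    | h f g => exact Quotient.sound (.swap_natural f g)
  swap_swap m n := Quotient.sound (.swap_swap m n)
  hexagon l m n := by
    rw [hopfPropData_eqId, hopfPropData_eqId, hopfPropData_eqId]
    exact Quotient.sound (.hexagon l m n)

/-- The generating commutative Hopf monoid: its structure morphisms are the classes of the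
generators. -/
def hopfPropHopf : hopfProp.CommHopfData where
  mul := Quotient.mk (HopfTerm.setoid 2 1) .mul
  one := Quotient.mk (HopfTerm.setoid 0 1) .one
  comul := Quotient.mk (HopfTerm.setoid 1 2) .comul
  counit := Quotient.mk (HopfTerm.setoid 1 0) .counit
  antipode := Quotient.mk (HopfTerm.setoid 1 1) .antipode
  mul_assoc := Quotient.sound .mul_assoc
  one_mul := Quotient.sound .one_mul
  mul_one := Quotient.sound .mul_one
  comul_assoc := Quotient.sound .comul_assoc
  counit_comul := Quotient.sound .counit_comul
  comul_counit := Quotient.sound .comul_counit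
  one_counit := Quotient.sound .one_counit
  mul_counit := Quotient.sound .mul_counit
  one_comul := Quotient.sound .one_comul
  mul_comul := Quotient.sound .mul_comul
  antipode_right := Quotient.sound .antipode_right
  antipode_left := Quotient.sound .antipode_left
  mul_comm := Quotient.sound .mul_comm

instance : HopfObj hopfProp.gen := hopfPropHopf.hopfObj

instance : IsCommMonObj hopfProp.gen where
  mul_comm := hopfPropHopf.mul_comm

/-! ### The category of finitely generated free groups -/

section FreeGroupProp

open FreeGroup

/-- The free product of two homomorphisms of free groups, where the free product of `F_m` and `F_n`
is identified with `F_(m + n)`: the generators of `F_m` go to the first `m` generators and those of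
`F_n` to the last `n` generators. -/
def freeGroupTensor {m n m' n' : ℕ} (f : FreeGroup (Fin m) →* FreeGroup (Fin n))
    (g : FreeGroup (Fin m') →* FreeGroup (Fin n')) :
    FreeGroup (Fin (m + m')) →* FreeGroup (Fin (n + n')) :=
  lift (Fin.append
    (fun i => map (Fin.castAdd n') (f (of i)))
    (fun j => map (Fin.natAdd n) (g (of j))))

/-- The homomorphism that interchanges the two factors of the free product of `F_m` and `F_n`. -/
def freeGroupSwap (m n : ℕ) : FreeGroup (Fin (m + n)) →* FreeGroup (Fin (n + m)) :=
  lift (Fin.append (fun i => of (Fin.natAdd n i)) (fun j => of (Fin.castAdd m j)))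

/-- The operations of the category of finitely generated free groups. -/
def freeGroupPropData : PropData where
  Hom m n := FreeGroup (Fin m) →* FreeGroup (Fin n)
  id n := MonoidHom.id (FreeGroup (Fin n))
  comp f g := g.comp f
  tensor := freeGroupTensor
  swap := freeGroupSwap

theorem freeGroupPropData_eqId {m n : ℕ} (h : m = n) :
    freeGroupPropData.eqId h = (map (Fin.cast h) : FreeGroup (Fin m) →* FreeGroup (Fin n)) := by
  subst h
  refine FreeGroup.ext_hom (MonoidHom.id _) _ fun _ => ?_
  simp

theorem freeGroupTensor_castAdd {m n m' n' : ℕ} (f : FreeGroup (Fin m) →* FreeGroup (Fin n))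
    (g : FreeGroup (Fin m') →* FreeGroup (Fin n')) (w : FreeGroup (Fin m)) :
    freeGroupTensor f g (map (Fin.castAdd m') w) = map (Fin.castAdd n') (f w) := by
  have : (freeGroupTensor f g).comp (map (Fin.castAdd m')) = (map (Fin.castAdd n')).comp f :=
    FreeGroup.ext_hom _ _ fun _ => by simp [freeGroupTensor]
  exact DFunLike.congr_fun this w

theorem freeGroupTensor_natAdd {m n m' n' : ℕ} (f : FreeGroup (Fin m) →* FreeGroup (Fin n))
    (g : FreeGroup (Fin m') →* FreeGroup (Fin n')) (w : FreeGroup (Fin m')) :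
    freeGroupTensor f g (map (Fin.natAdd m) w) = map (Fin.natAdd n) (g w) := by
  have : (freeGroupTensor f g).comp (map (Fin.natAdd m)) = (map (Fin.natAdd n)).comp g :=
    FreeGroup.ext_hom _ _ fun _ => by simp [freeGroupTensor]
  exact DFunLike.congr_fun this w

theorem freeGroupSwap_castAdd {m n : ℕ} (w : FreeGroup (Fin m)) :
    freeGroupSwap m n (map (Fin.castAdd n) w) = map (Fin.natAdd n) w := by
  have : (freeGroupSwap m n).comp (map (Fin.castAdd n)) = map (Fin.natAdd n) :=
    FreeGroup.ext_hom _ _ fun _ => by simp [freeGroupSwap]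
  exact DFunLike.congr_fun this w

theorem freeGroupSwap_natAdd {m n : ℕ} (w : FreeGroup (Fin n)) :
    freeGroupSwap m n (map (Fin.natAdd m) w) = map (Fin.castAdd m) w := by
  have : (freeGroupSwap m n).comp (map (Fin.natAdd m)) = map (Fin.castAdd m) :=
    FreeGroup.ext_hom _ _ fun _ => by simp [freeGroupSwap]
  exact DFunLike.congr_fun this w

/-- Two homomorphisms from `F_(m + n)` agree when they agree on the two factors. -/
theorem freeGroup_ext_add {m n : ℕ} {G : Type} [Group G] {f g : FreeGroup (Fin (m + n)) →* G}
    (h₁ : ∀ w, f (map (Fin.castAdd n) w) = g (map (Fin.castAdd n) w))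
    (h₂ : ∀ w, f (map (Fin.natAdd m) w) = g (map (Fin.natAdd m) w)) : f = g := by
  refine FreeGroup.ext_hom _ _ fun i => ?_
  refine Fin.addCases (fun i => ?_) (fun j => ?_) i
  · simpa using h₁ (of i)
  · simpa using h₂ (of j)

theorem freeGroup_cast_left (a b c : ℕ) (w : FreeGroup (Fin a)) :
    map (Fin.cast (Nat.add_assoc a b c)) (map (Fin.castAdd c) (map (Fin.castAdd b) w)) =
      map (Fin.castAdd (b + c)) w := by
  rw [map.comp, map.comp]; rfl

theorem freeGroup_cast_mid (a b c : ℕ) (w : FreeGroup (Fin b)) :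
    map (Fin.cast (Nat.add_assoc a b c)) (map (Fin.castAdd c) (map (Fin.natAdd a) w)) =
      map (Fin.natAdd a) (map (Fin.castAdd c) w) := by
  rw [map.comp, map.comp, map.comp]; rfl

theorem freeGroup_cast_right (a b c : ℕ) (w : FreeGroup (Fin c)) :
    map (Fin.cast (Nat.add_assoc a b c)) (map (Fin.natAdd (a + b)) w) =
      map (Fin.natAdd a) (map (Fin.natAdd b) w) := by
  rw [map.comp, map.comp]
  congr 2
  funext i
  exact Fin.ext (Nat.add_assoc a b i)

/-- The full subcategory of the category of groups on the free groups `F_n = FreeGroup (Fin n)`, with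
the free product as tensor product and the interchange of the factors as symmetry. -/
def freeGroupProp : StrictProp where
  toPropData := freeGroupPropData
  id_comp f := MonoidHom.comp_id f
  comp_id f := MonoidHom.id_comp f
  assoc f g h := (MonoidHom.comp_assoc f g h).symm
  tensor_id m n := freeGroup_ext_add (m := m) (n := n)
    (fun w => freeGroupTensor_castAdd _ _ w) (fun w => freeGroupTensor_natAdd _ _ w)
  tensor_comp {l m n l' m' n'} f g f' g' := by
    change FreeGroup (Fin l) →* FreeGroup (Fin m) at f
    change FreeGroup (Fin m) →* FreeGroup (Fin n) at g
    change FreeGroup (Fin l') →* FreeGroup (Fin m') at f'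
    change FreeGroup (Fin m') →* FreeGroup (Fin n') at g'
    change freeGroupTensor (MonoidHom.comp g f) (MonoidHom.comp g' f') =
      (freeGroupTensor g g').comp (freeGroupTensor f f')
    refine freeGroup_ext_add (fun w => ?_) (fun w => ?_)
    · simp only [MonoidHom.comp_apply, freeGroupTensor_castAdd]
    · simp only [MonoidHom.comp_apply, freeGroupTensor_natAdd]
  tensor_assoc {m n m' n' m'' n''} f g h := by
    rw [freeGroupPropData_eqId, freeGroupPropData_eqId]
    change FreeGroup (Fin m) →* FreeGroup (Fin n) at f
    change FreeGroup (Fin m') →* FreeGroup (Fin n') at g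
    change FreeGroup (Fin m'') →* FreeGroup (Fin n'') at h
    change (map (Fin.cast _)).comp (freeGroupTensor (freeGroupTensor f g) h) =
      (freeGroupTensor f (freeGroupTensor g h)).comp (map (Fin.cast _))
    refine freeGroup_ext_add (fun w => ?_) (fun w => ?_)
    · refine DFunLike.congr_fun (f := ((map (Fin.cast _)).comp
        (freeGroupTensor (freeGroupTensor f g) h)).comp (map (Fin.castAdd m'')))
        (g := ((freeGroupTensor f (freeGroupTensor g h)).comp (map (Fin.cast _))).comp
          (map (Fin.castAdd m''))) ?_ w
      refine freeGroup_ext_add (fun w => ?_) (fun w => ?_)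
      · simp only [MonoidHom.comp_apply, freeGroupTensor_castAdd, freeGroup_cast_left]
      · simp only [MonoidHom.comp_apply, freeGroupTensor_castAdd, freeGroupTensor_natAdd,
          freeGroup_cast_mid]
    · simp only [MonoidHom.comp_apply, freeGroupTensor_natAdd, freeGroup_cast_right]
  unit_tensor {m n} f := by
    rw [freeGroupPropData_eqId, freeGroupPropData_eqId]
    change FreeGroup (Fin m) →* FreeGroup (Fin n) at f
    change (map (Fin.cast _)).comp (freeGroupTensor (MonoidHom.id _) f) =
      MonoidHom.comp f (map (Fin.cast _))
    have key : ∀ (k : ℕ) (w : FreeGroup (Fin k)),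
        map (Fin.cast (Nat.zero_add k)) (map (Fin.natAdd 0) w) = w := fun k w => by
      rw [map.comp]
      convert map.id w
      funext i
      exact Fin.ext (Nat.zero_add i)
    refine freeGroup_ext_add (fun w => ?_) (fun w => ?_)
    · rw [Subsingleton.elim w 1]; simp only [_root_.map_one]
    · simp only [MonoidHom.comp_apply, freeGroupTensor_natAdd, key]
  tensor_unit {m n} f := by
    rw [freeGroupPropData_eqId, freeGroupPropData_eqId]
    change FreeGroup (Fin m) →* FreeGroup (Fin n) at f
    change (map (Fin.cast _)).comp (freeGroupTensor f (MonoidHom.id (FreeGroup (Fin 0)))) =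
      MonoidHom.comp f (map (Fin.cast _))
    have key : ∀ (k : ℕ) (w : FreeGroup (Fin k)),
        map (Fin.cast (Nat.add_zero k)) (map (Fin.castAdd 0) w) = w := fun k w => by
      rw [map.comp]
      exact map.id w
    refine freeGroup_ext_add (fun w => ?_) (fun w => ?_)
    · simp only [MonoidHom.comp_apply, freeGroupTensor_castAdd, key]
    · rw [Subsingleton.elim w 1]; simp only [_root_.map_one]
  swap_natural {m n m' n'} f g := by
    change FreeGroup (Fin m) →* FreeGroup (Fin n) at f
    change FreeGroup (Fin m') →* FreeGroup (Fin n') at g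
    change (freeGroupSwap n n').comp (freeGroupTensor f g) =
      (freeGroupTensor g f).comp (freeGroupSwap m m')
    refine freeGroup_ext_add (fun w => ?_) (fun w => ?_) <;>
      simp only [MonoidHom.comp_apply, freeGroupTensor_castAdd, freeGroupTensor_natAdd,
        freeGroupSwap_castAdd, freeGroupSwap_natAdd]
  swap_swap m n := by
    change (freeGroupSwap n m).comp (freeGroupSwap m n) = MonoidHom.id _
    refine freeGroup_ext_add (fun w => ?_) (fun w => ?_) <;>
      simp only [MonoidHom.comp_apply, MonoidHom.id_apply,
        freeGroupSwap_castAdd, freeGroupSwap_natAdd]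
  hexagon l m n := by
    rw [freeGroupPropData_eqId, freeGroupPropData_eqId, freeGroupPropData_eqId]
    change ((map (Fin.cast (Nat.add_assoc m n l))).comp (freeGroupSwap l (m + n))).comp
        (map (Fin.cast (Nat.add_assoc l m n))) =
      ((freeGroupTensor (MonoidHom.id _) (freeGroupSwap l n)).comp
        (map (Fin.cast (Nat.add_assoc m l n)))).comp
          (freeGroupTensor (freeGroupSwap l m) (MonoidHom.id _))
    refine freeGroup_ext_add (fun w => ?_) (fun w => ?_)
    · refine DFunLike.congr_fun
        (f := (((map (Fin.cast (Nat.add_assoc m n l))).comp (freeGroupSwap l (m + n))).comp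
          (map (Fin.cast (Nat.add_assoc l m n)))).comp (map (Fin.castAdd n)))
        (g := (((freeGroupTensor (MonoidHom.id _) (freeGroupSwap l n)).comp
          (map (Fin.cast (Nat.add_assoc m l n)))).comp
          (freeGroupTensor (freeGroupSwap l m) (MonoidHom.id _))).comp (map (Fin.castAdd n))) ?_ w
      refine freeGroup_ext_add (fun w => ?_) (fun w => ?_) <;>
        simp only [MonoidHom.comp_apply, MonoidHom.id_apply, freeGroupTensor_castAdd,
          freeGroupTensor_natAdd, freeGroupSwap_castAdd, freeGroupSwap_natAdd,
          freeGroup_cast_left, freeGroup_cast_mid, freeGroup_cast_right]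
    · simp only [MonoidHom.comp_apply, MonoidHom.id_apply, freeGroupTensor_castAdd,
          freeGroupTensor_natAdd, freeGroupSwap_castAdd, freeGroupSwap_natAdd,
          freeGroup_cast_left, freeGroup_cast_mid, freeGroup_cast_right]

/-- The commutative Hopf monoid `F_1`. In terms of the images of the generators, the multiplication
is `x₁, x₂ ↦ x₁`, the unit is the homomorphism from the trivial group, the comultiplication is
`x₁ ↦ x₁ x₂`, the counit is the homomorphism to the trivial group and the antipode is
`x₁ ↦ x₁⁻¹`. -/
def freeGroupPropHopf : freeGroupProp.CommHopfData where
  mul := (lift ![of 0, of 0] : FreeGroup (Fin 2) →* FreeGroup (Fin 1))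
  one := (lift ![] : FreeGroup (Fin 0) →* FreeGroup (Fin 1))
  comul := (lift ![of 0 * of 1] : FreeGroup (Fin 1) →* FreeGroup (Fin 2))
  counit := (lift ![1] : FreeGroup (Fin 1) →* FreeGroup (Fin 0))
  antipode := (lift ![(of 0)⁻¹] : FreeGroup (Fin 1) →* FreeGroup (Fin 1))
  mul_assoc := FreeGroup.ext_hom (α := Fin 3) _ _ fun i => by fin_cases i <;> rfl
  one_mul := FreeGroup.ext_hom (α := Fin 1) _ _ fun i => by fin_cases i <;> rfl
  mul_one := FreeGroup.ext_hom (α := Fin 1) _ _ fun i => by fin_cases i <;> rfl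
  comul_assoc := FreeGroup.ext_hom (α := Fin 1) _ _ fun i => by fin_cases i <;> rfl
  counit_comul := FreeGroup.ext_hom (α := Fin 1) _ _ fun i => by fin_cases i <;> rfl
  comul_counit := FreeGroup.ext_hom (α := Fin 1) _ _ fun i => by fin_cases i <;> rfl
  one_counit := FreeGroup.ext_hom (α := Fin 0) _ _ fun i => i.elim0
  mul_counit := FreeGroup.ext_hom (α := Fin 2) _ _ fun i => by fin_cases i <;> rfl
  one_comul := FreeGroup.ext_hom (α := Fin 0) _ _ fun i => i.elim0
  mul_comul := FreeGroup.ext_hom (α := Fin 2) _ _ fun i => by fin_cases i <;> rfl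
  antipode_right := FreeGroup.ext_hom (α := Fin 1) _ _ fun i => by
    fin_cases i
    exact mul_inv_cancel (of (0 : Fin 1))
  antipode_left := FreeGroup.ext_hom (α := Fin 1) _ _ fun i => by
    fin_cases i
    exact inv_mul_cancel (of (0 : Fin 1))
  mul_comm := FreeGroup.ext_hom (α := Fin 2) _ _ fun i => by fin_cases i <;> rfl

end FreeGroupProp

instance : HopfObj freeGroupProp.gen := freeGroupPropHopf.hopfObj

instance : IsCommMonObj freeGroupProp.gen where
  mul_comm := freeGroupPropHopf.mul_comm

/-! In the free category the tensor product is a coproduct. By the bimonoid axioms `Δ` and `ε` are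
morphisms of monoids, and so is every unit; since the Hopf monoid is commutative, `μ` and `S` are
too. Monoid morphisms are closed under composition and tensor product, and the symmetry is one, so
every morphism between tensor powers is a monoid morphism (`hopfProp_isMonHom`). A monoid morphism
out of `X ⊗ Y` is determined by its restrictions along `inl` and `inr`, and `(f ⊗ g) ≫ μ` has
restrictions `f` and `g`. Hence the object `n` is the `n`-fold coproduct of the generator, with
coprojections `hopfCoord`.

Consequently the morphisms from the generator to `n` form a group under convolution, where the
inverse of `f` is `S ≫ f`, and postcomposition is a group homomorphism. Sending the free generators
to the coprojections gives `hopfWord` from `F_n` to this group.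

Evaluation of terms in free groups respects all relations, which gives the functor. Two facts make
it bijective on morphisms. First, `hopfWord_eval`: the word of `T f w` is the word of `w` followed
by `f`. So `T f` determines the composite of `f` with each coprojection, hence `f`. Second,
`hopfEval_word`: the word of `w`, evaluated at the generator of `F_1`, is `w`. So a homomorphism `g`
is the image of the morphism with components the words of the `g x_i`. As the functor is the
identity on objects, it is an isomorphism of categories. Uniqueness is induction on terms, since
strictness and the values on the Hopf structure fix the value on every term. -/

/-! ### Commutative monoids and coproducts -/

namespace HopfCoproduct

open scoped MonObj ComonObj HopfObj

variable {C : Type*} [Category C] [MonoidalCategory C]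

/-- The morphism `X ⟶ X ⊗ Y` given by the unit of `Y`. -/
def inl (X Y : C) [MonObj Y] : X ⟶ X ⊗ Y := (ρ_ X).inv ≫ X ◁ η[Y]

/-- The morphism `Y ⟶ X ⊗ Y` given by the unit of `X`. -/
def inr (X Y : C) [MonObj X] : Y ⟶ X ⊗ Y := (λ_ Y).inv ≫ η[X] ▷ Y

/-- The morphism from `X ⊗ Y` to a monoid with given restrictions to `X` and `Y`. -/
def desc {X Y Z : C} [MonObj Z] (f : X ⟶ Z) (g : Y ⟶ Z) : X ⊗ Y ⟶ Z := (f ⊗ₘ g) ≫ μ[Z]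

/-- The convolution product of two morphisms from a comonoid to a monoid. -/
def conv {X Z : C} [ComonObj X] [MonObj Z] (f g : X ⟶ Z) : X ⟶ Z := Δ[X] ≫ desc f g

/-- Naturality of the coprojection. Of the monoid morphism `g`, only preservation of the unit
matters. -/
theorem inl_tensorHom {X Y X' Y' : C} [MonObj Y] [MonObj Y'] (f : X ⟶ X') (g : Y ⟶ Y')
    [IsMonHom g] : inl X Y ≫ (f ⊗ₘ g) = f ≫ inl X' Y' := by
  rw [inl, tensorHom_def', Category.assoc, ← whiskerLeft_comp_assoc, IsMonHom.one_hom,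
    whisker_exchange, inl, rightUnitor_inv_naturality_assoc]

theorem inr_tensorHom {X Y X' Y' : C} [MonObj X] [MonObj X'] (f : X ⟶ X') (g : Y ⟶ Y')
    [IsMonHom f] : inr X Y ≫ (f ⊗ₘ g) = g ≫ inr X' Y' := by
  rw [inr, MonoidalCategory.tensorHom_def, Category.assoc, ← comp_whiskerRight_assoc,
    IsMonHom.one_hom, ← whisker_exchange, inr, leftUnitor_inv_naturality_assoc]

theorem inl_desc {X Y Z : C} [MonObj Y] [MonObj Z] (f : X ⟶ Z) (g : Y ⟶ Z) [IsMonHom g] :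
    inl X Y ≫ desc f g = f := by
  rw [desc, ← Category.assoc, inl_tensorHom]
  simp [inl]

theorem inr_desc {X Y Z : C} [MonObj X] [MonObj Z] (f : X ⟶ Z) (g : Y ⟶ Z) [IsMonHom f] :
    inr X Y ≫ desc f g = g := by
  rw [desc, ← Category.assoc, inr_tensorHom]
  simp [inr]

theorem desc_comp {X Y Z W : C} [MonObj Z] [MonObj W] (f : X ⟶ Z) (g : Y ⟶ Z) (h : Z ⟶ W)
    [IsMonHom h] : desc f g ≫ h = desc (f ≫ h) (g ≫ h) := by
  rw [desc, desc, Category.assoc, IsMonHom.mul_hom, tensorHom_comp_tensorHom_assoc]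

theorem conv_comp {X Z W : C} [ComonObj X] [MonObj Z] [MonObj W] (f g : X ⟶ Z) (h : Z ⟶ W)
    [IsMonHom h] : conv f g ≫ h = conv (f ≫ h) (g ≫ h) := by
  rw [conv, conv, Category.assoc, desc_comp]

/-- This is the form of the product on `Conv X Z`, from which `convGroup` takes associativity and
the unit laws. -/
theorem conv_eq_whisker {X Z : C} [ComonObj X] [MonObj Z] (f g : X ⟶ Z) :
    conv f g = Δ[X] ≫ f ▷ X ≫ Z ◁ g ≫ μ[Z] := by
  rw [conv, desc, MonoidalCategory.tensorHom_def, Category.assoc]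

theorem isMonHom_one (X : C) [MonObj X] : IsMonHom η[X] where
  one_hom := Category.id_comp _
  mul_hom := by
    rw [MonObj.one_mul_hom]
    rfl

/-- Together with `inl_inl_associator` and `inr_associator`: the three coprojections into a triple
tensor product do not depend on the bracketing. -/
theorem inr_inl_associator (X Y Z : C) [MonObj X] [MonObj Z] :
    inr X Y ≫ inl (X ⊗ Y) Z ≫ (α_ X Y Z).hom = inl Y Z ≫ inr X (Y ⊗ Z) := by
  simp only [inl, inr, Category.assoc]
  rw [associator_naturality_right, rightUnitor_tensor_inv_assoc, Iso.inv_hom_id_assoc,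
    ← whiskerLeft_comp, ← whisker_exchange, leftUnitor_inv_naturality_assoc,
    leftUnitor_inv_naturality_assoc, whiskerLeft_comp_assoc]

section Braided

variable [BraidedCategory C]

theorem inl_inl_associator (X Y Z : C) [MonObj Y] [MonObj Z] :
    inl X Y ≫ inl (X ⊗ Y) Z ≫ (α_ X Y Z).hom = inl X (Y ⊗ Z) := by
  simp only [inl, MonObj.tensorObj.one_def, MonoidalCategory.tensorHom_def,
    whiskerLeft_comp, Category.assoc]
  rw [associator_naturality_right, rightUnitor_tensor_inv_assoc, Iso.inv_hom_id_assoc,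
    ← whiskerLeft_comp_assoc X η[Y], rightUnitor_inv_naturality, unitors_inv_equal,
    whiskerLeft_comp_assoc]

theorem inr_associator (X Y Z : C) [MonObj X] [MonObj Y] :
    inr (X ⊗ Y) Z ≫ (α_ X Y Z).hom = inr Y Z ≫ inr X (Y ⊗ Z) := by
  simp only [inr, MonObj.tensorObj.one_def, tensorHom_def', Category.assoc, comp_whiskerRight]
  rw [associator_naturality_left, associator_naturality_middle_assoc,
    leftUnitor_inv_naturality_assoc]
  simp

theorem inl_braiding (X Y : C) [MonObj Y] : inl X Y ≫ (β_ X Y).hom = inr Y X := by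
  simp [inl, inr]

theorem inr_braiding (X Y : C) [MonObj X] : inr X Y ≫ (β_ X Y).hom = inl Y X := by
  simp [inl, inr]

/-- In the multiplication of `X ⊗ Y`, the factors interchanged in the middle are here both the unit
object, so the interchange is trivial and the unit laws of `X` and `Y` finish. -/
theorem desc_inl_inr (X Y : C) [MonObj X] [MonObj Y] : desc (inl X Y) (inr X Y) = 𝟙 (X ⊗ Y) := by
  have h : tensorμ X (𝟙_ C) (𝟙_ C) Y = 𝟙 _ := by
    rw [tensorμ, braiding_tensorUnit_left]
    monoidal
  rw [desc, inl, inr, MonObj.tensorObj.mul_def, ← tensorHom_comp_tensorHom, Category.assoc,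
    ← id_tensorHom, ← tensorHom_id, tensorμ_natural_assoc, h, Category.id_comp,
    tensorHom_comp_tensorHom, id_tensorHom, tensorHom_id, MonObj.mul_one, MonObj.one_mul,
    tensorHom_comp_tensorHom]
  simp

/-- Uniqueness for the coproduct: a monoid morphism `f` satisfies `f = desc (inl X Y) (inr X Y) ≫ f
= desc (inl X Y ≫ f) (inr X Y ≫ f)`. -/
theorem tensor_hom_ext {X Y Z : C} [MonObj X] [MonObj Y] [MonObj Z] {f g : X ⊗ Y ⟶ Z}
    [IsMonHom f] [IsMonHom g] (h₁ : inl X Y ≫ f = inl X Y ≫ g) (h₂ : inr X Y ≫ f = inr X Y ≫ g) :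
    f = g := by
  rw [← Category.id_comp f, ← Category.id_comp g, ← desc_inl_inr, desc_comp, desc_comp, h₁, h₂]

theorem isMonHom_mul (X : C) [MonObj X] [IsCommMonObj X] : IsMonHom μ[X] where
  one_hom := by
    rw [MonObj.tensorObj.one_def, Category.assoc, MonObj.one_mul_hom, Iso.inv_hom_id_assoc]
  mul_hom := by simp [MonObj.tensorObj.mul_def]

theorem isMonHom_comul (X : C) [BimonObj X] : IsMonHom Δ[X] where
  one_hom := BimonObj.one_comul X
  mul_hom := BimonObj.mul_comul X

theorem isMonHom_counit (X : C) [BimonObj X] : IsMonHom ε[X] where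
  one_hom := BimonObj.one_counit X
  mul_hom := BimonObj.mul_counit X

/-- The antipode reverses products in general; commutativity undoes the reversal. -/
theorem isMonHom_antipode (X : C) [HopfObj X] [IsCommMonObj X] : IsMonHom 𝒮[X] where
  one_hom := HopfObj.one_antipode X
  mul_hom := by rw [HopfObj.mul_antipode, IsCommMonObj.mul_comm]

/-- When a morphism from a Hopf monoid to a monoid is a morphism of monoids, its composite with the
antipode is a convolution inverse. -/
theorem conv_antipode {X Z : C} [HopfObj X] [MonObj Z] (f : X ⟶ Z) [IsMonHom f] :
    conv (𝒮[X] ≫ f) f = ε[X] ≫ η[Z] := by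
  have h : conv (𝒮[X] ≫ f) f = conv 𝒮[X] (𝟙 X) ≫ f := by rw [conv_comp, Category.id_comp]
  rw [h, conv, desc, tensorHom_id, HopfObj.antipode_left, Category.assoc, IsMonHom.one_hom]

/-- The convolution group of morphisms from a Hopf monoid to a monoid, when these all are morphisms
of monoids. -/
abbrev convGroup (X Z : C) [HopfObj X] [MonObj Z] (h : ∀ f : X ⟶ Z, IsMonHom f) :
    Group (X ⟶ Z) where
  mul := conv
  one := ε[X] ≫ η[Z]
  inv f := 𝒮[X] ≫ f
  mul_assoc f g k := by
    change conv (conv f g) k = conv f (conv g k)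
    simp only [conv_eq_whisker]
    exact mul_assoc (G := Conv X Z) f g k
  one_mul f := (conv_eq_whisker _ f).trans (one_mul (M := Conv X Z) f)
  mul_one f := (conv_eq_whisker f _).trans (mul_one (M := Conv X Z) f)
  -- Composition with the antipode inverts `f` because `f` is a monoid morphism, hence the
  -- hypothesis `h` on all morphisms.
  inv_mul_cancel f := haveI := h f; conv_antipode f

end Braided

end HopfCoproduct

/-! ### Monoid structures on the tensor powers of a commutative Hopf monoid -/

section ExplicitStructures

variable {C : Type*} [Category C] [MonoidalCategory C]

/-- Turns structural isomorphisms that are identities, as in a strict category, into equalities of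
monoid structures. -/
theorem monObj_eq_of_isMonHom_id {X : C} (h₁ h₂ : MonObj X)
    (h : @IsMonHom C _ _ X X h₁ h₂ (𝟙 X)) : h₁ = h₂ := by
  refine MonObj.ext _ _ ?_
  have := @IsMonHom.mul_hom C _ _ X X h₁ h₂ (𝟙 X) h
  rwa [Category.comp_id, id_tensorHom_id, Category.id_comp] at this

/-- Here and below the monoid structures are variables rather than inferred instances, because the
structure on a tensor power agrees with that of a tensor product only by a proved equality. -/
theorem isMonHom_comp {X Y Z : C} {hX : MonObj X} {hY : MonObj Y} {hZ : MonObj Z} {f : X ⟶ Y}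
    {g : Y ⟶ Z} (hf : IsMonHom f) (hg : IsMonHom g) : IsMonHom (f ≫ g) :=
  inferInstance

variable [BraidedCategory C]

/-- The tensor product of two monoids. -/
abbrev monTensor {X Y : C} (hX : MonObj X) (hY : MonObj Y) : MonObj (X ⊗ Y) :=
  MonObj.tensorObj.instTensorObj

theorem isMonHom_tensorHom {X Y X' Y' : C} {hX : MonObj X} {hY : MonObj Y} {hX' : MonObj X'}
    {hY' : MonObj Y'} {f : X ⟶ Y} {g : X' ⟶ Y'} (hf : IsMonHom f) (hg : IsMonHom g) :
    @IsMonHom C _ _ _ _ (monTensor hX hX') (monTensor hY hY') (f ⊗ₘ g) :=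
  inferInstance

theorem isMonHom_associator {X Y Z : C} (hX : MonObj X) (hY : MonObj Y) (hZ : MonObj Z) :
    @IsMonHom C _ _ _ _ (monTensor (monTensor hX hY) hZ) (monTensor hX (monTensor hY hZ))
      (α_ X Y Z).hom :=
  inferInstance

theorem isMonHom_leftUnitor {X : C} (hX : MonObj X) :
    @IsMonHom C _ _ _ _ (monTensor (inferInstance : MonObj (𝟙_ C)) hX) hX (λ_ X).hom :=
  inferInstance

theorem isMonHom_rightUnitor {X : C} (hX : MonObj X) :
    @IsMonHom C _ _ _ _ (monTensor hX (inferInstance : MonObj (𝟙_ C))) hX (ρ_ X).hom :=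
  inferInstance

theorem isMonHom_braiding {C : Type*} [Category C] [MonoidalCategory C] [SymmetricCategory C]
    {X Y : C} (hX : MonObj X) (hY : MonObj Y) :
    @IsMonHom C _ _ _ _ (monTensor hX hY) (monTensor hY hX) (β_ X Y).hom :=
  inferInstance

end ExplicitStructures

namespace StrictProp

variable (P : StrictProp)

/-- The monoid structure on the tensor powers of a monoid structure on the generating object. -/
@[reducible]
def powMon [h : MonObj P.gen] (X : P.Obj) : MonObj X :=
  Nat.rec (motive := fun n => @MonObj P.Obj _ _ n) (inferInstance : MonObj (𝟙_ P.Obj))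
    (fun n hn => @monTensor P.Obj _ _ _ n P.gen hn h) X

/-- Induction on `Y`: the right unitor and the associator with last factor `gen` are monoid
morphisms, and on these objects they are identities by definition. -/
theorem powMon_tensor [MonObj P.gen] (X Y : P.Obj) :
    P.powMon (X ⊗ Y : P.Obj) = monTensor (P.powMon X) (P.powMon Y) := by
  change ℕ at Y
  induction Y with
  | zero => exact (monObj_eq_of_isMonHom_id (C := P.Obj) _ _ (isMonHom_rightUnitor _)).symm
  | succ n ih =>
    refine Eq.trans (b := monTensor (C := P.Obj) (monTensor (P.powMon X) (P.powMon n)) _) ?_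
      (monObj_eq_of_isMonHom_id (C := P.Obj) _ _
        (isMonHom_associator (C := P.Obj) (Y := n) (Z := P.gen) (P.powMon X) (P.powMon n) _))
    rw [← ih]
    rfl

theorem powMon_gen [h : MonObj P.gen] : P.powMon P.gen = h :=
  monObj_eq_of_isMonHom_id (C := P.Obj) _ _ (isMonHom_leftUnitor _)

theorem isMonHom_powMon_tensorHom [MonObj P.gen] {X Y X' Y' : P.Obj} {f : X ⟶ Y} {g : X' ⟶ Y'}
    (hf : @IsMonHom _ _ _ X Y (P.powMon X) (P.powMon Y) f)
    (hg : @IsMonHom _ _ _ X' Y' (P.powMon X') (P.powMon Y') g) :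
    @IsMonHom _ _ _ _ _ (P.powMon (X ⊗ X')) (P.powMon (Y ⊗ Y')) (f ⊗ₘ g) := by
  rw [powMon_tensor, powMon_tensor]
  exact isMonHom_tensorHom hf hg

theorem isMonHom_powMon_braiding [MonObj P.gen] (X Y : P.Obj) :
    @IsMonHom _ _ _ _ _ (P.powMon (X ⊗ Y)) (P.powMon (Y ⊗ X)) (β_ X Y).hom := by
  rw [powMon_tensor, powMon_tensor]
  exact isMonHom_braiding _ _

end StrictProp

/-! ### Every morphism of the free category is a morphism of monoids -/

open scoped MonObj ComonObj HopfObj in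
theorem hopfProp_isMonHom_term {m n : ℕ} (f : HopfTerm m n) :
    @IsMonHom hopfProp.Obj _ _ m n (hopfProp.powMon m) (hopfProp.powMon n)
      (Quotient.mk (HopfTerm.setoid m n) f) := by
  induction f with
  | id n => exact @MonObj.instIsMonHomId hopfProp.Obj _ _ n (hopfProp.powMon n)
  | @comp l m n f g ihf ihg => exact isMonHom_comp (C := hopfProp.Obj) ihf ihg
  | @tensor m n m' n' f g ihf ihg => exact hopfProp.isMonHom_powMon_tensorHom ihf ihg
  | swap m n => exact hopfProp.isMonHom_powMon_braiding m n
  | mul =>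
    -- The object `2` is displayed as `gen ⊗ gen`, so that `powMon_tensor` applies.
    change @IsMonHom _ _ _ _ _ (hopfProp.powMon (hopfProp.gen ⊗ hopfProp.gen))
      (hopfProp.powMon hopfProp.gen) μ[hopfProp.gen]
    rw [StrictProp.powMon_tensor, StrictProp.powMon_gen]
    exact HopfCoproduct.isMonHom_mul hopfProp.gen
  | one =>
    change @IsMonHom _ _ _ _ _ (hopfProp.powMon (𝟙_ hopfProp.Obj))
      (hopfProp.powMon hopfProp.gen) η[hopfProp.gen]
    rw [StrictProp.powMon_gen]
    exact HopfCoproduct.isMonHom_one hopfProp.gen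
  | comul =>
    change @IsMonHom _ _ _ _ _ (hopfProp.powMon hopfProp.gen)
      (hopfProp.powMon (hopfProp.gen ⊗ hopfProp.gen)) Δ[hopfProp.gen]
    rw [StrictProp.powMon_tensor, StrictProp.powMon_gen]
    exact HopfCoproduct.isMonHom_comul hopfProp.gen
  | counit =>
    change @IsMonHom _ _ _ _ _ (hopfProp.powMon hopfProp.gen)
      (hopfProp.powMon (𝟙_ hopfProp.Obj)) ε[hopfProp.gen]
    rw [StrictProp.powMon_gen]
    exact HopfCoproduct.isMonHom_counit hopfProp.gen
  | antipode =>
    change @IsMonHom _ _ _ _ _ (hopfProp.powMon hopfProp.gen)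
      (hopfProp.powMon hopfProp.gen) 𝒮[hopfProp.gen]
    rw [StrictProp.powMon_gen]
    exact HopfCoproduct.isMonHom_antipode hopfProp.gen

/-- Every morphism between tensor powers of the generating Hopf monoid is a morphism of monoids. -/
theorem hopfProp_isMonHom {X Y : hopfProp.Obj} (f : X ⟶ Y) :
    @IsMonHom _ _ _ X Y (hopfProp.powMon X) (hopfProp.powMon Y) f := by
  induction f using Quotient.inductionOn with | h f => exact hopfProp_isMonHom_term f

/-! ### Evaluation of terms in the category of free groups -/

/-- The homomorphism of free groups denoted by a term. -/
def HopfTerm.eval : ∀ {m n : ℕ}, HopfTerm m n → freeGroupProp.Hom m n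
  | _, _, .id n => freeGroupProp.id n
  | _, _, .comp f g => freeGroupProp.comp f.eval g.eval
  | _, _, .tensor f g => freeGroupProp.tensor f.eval g.eval
  | _, _, .swap m n => freeGroupProp.swap m n
  | _, _, .mul => freeGroupPropHopf.mul
  | _, _, .one => freeGroupPropHopf.one
  | _, _, .comul => freeGroupPropHopf.comul
  | _, _, .counit => freeGroupPropHopf.counit
  | _, _, .antipode => freeGroupPropHopf.antipode

theorem HopfTerm.eval_eqId {m n : ℕ} (h : m = n) :
    (HopfTerm.eqId h).eval = freeGroupProp.eqId h := by
  subst h; rfl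

theorem HopfTerm.Rel.eval_eq {m n : ℕ} {f g : HopfTerm m n} (h : HopfTerm.Rel f g) :
    f.eval = g.eval := by
  induction h with
  | refl => rfl
  | symm _ ih => exact ih.symm
  | trans _ _ ih ih' => exact ih.trans ih'
  | comp_congr _ _ ih ih' => exact congrArg₂ freeGroupProp.comp ih ih'
  | tensor_congr _ _ ih ih' => exact congrArg₂ freeGroupProp.tensor ih ih'
  | id_comp => exact freeGroupProp.id_comp _
  | comp_id => exact freeGroupProp.comp_id _
  | assoc => exact freeGroupProp.assoc _ _ _
  | tensor_id => exact freeGroupProp.tensor_id _ _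
  | tensor_comp => exact freeGroupProp.tensor_comp _ _ _ _
  | tensor_assoc => simp only [eval, eval_eqId]; exact freeGroupProp.tensor_assoc _ _ _
  | unit_tensor => simp only [eval, eval_eqId]; exact freeGroupProp.unit_tensor _
  | tensor_unit => simp only [eval, eval_eqId]; exact freeGroupProp.tensor_unit _
  | swap_natural => exact freeGroupProp.swap_natural _ _
  | swap_swap => exact freeGroupProp.swap_swap _ _
  | hexagon => simp only [eval, eval_eqId]; exact freeGroupProp.hexagon _ _ _
  | mul_assoc => exact freeGroupPropHopf.mul_assoc
  | one_mul => exact freeGroupPropHopf.one_mul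
  | mul_one => exact freeGroupPropHopf.mul_one
  | comul_assoc => exact freeGroupPropHopf.comul_assoc
  | counit_comul => exact freeGroupPropHopf.counit_comul
  | comul_counit => exact freeGroupPropHopf.comul_counit
  | one_counit => exact freeGroupPropHopf.one_counit
  | mul_counit => exact freeGroupPropHopf.mul_counit
  | one_comul => exact freeGroupPropHopf.one_comul
  | mul_comul => exact freeGroupPropHopf.mul_comul
  | antipode_right => exact freeGroupPropHopf.antipode_right
  | antipode_left => exact freeGroupPropHopf.antipode_left
  | mul_comm => exact freeGroupPropHopf.mul_comm

/-- The tensor power `n` of the generating object. -/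
def hopfPow (n : ℕ) : hopfProp.Obj := n

/-- The homomorphism of free groups denoted by a class of terms. -/
def hopfEval {m n : ℕ} (f : hopfPow m ⟶ hopfPow n) : FreeGroup (Fin m) →* FreeGroup (Fin n) :=
  Quotient.lift HopfTerm.eval (fun _ _ h => HopfTerm.Rel.eval_eq h) f

theorem hopfEval_comp {l m n : ℕ} (f : hopfPow l ⟶ hopfPow m) (g : hopfPow m ⟶ hopfPow n) :
    hopfEval (f ≫ g) = (hopfEval g).comp (hopfEval f) := by
  induction f, g using Quotient.inductionOn₂ with | h f g => rfl

theorem hopfEval_tensor {m n m' n' : ℕ} (f : hopfPow m ⟶ hopfPow n) (g : hopfPow m' ⟶ hopfPow n') :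
    hopfEval (m := m + m') (n := n + n') (f ⊗ₘ g) = freeGroupTensor (hopfEval f) (hopfEval g) := by
  induction f, g using Quotient.inductionOn₂ with | h f g => rfl

theorem hopfEval_eqToHom {m n : ℕ} (h : m = n) :
    hopfEval (eqToHom (show hopfPow m = hopfPow n from h)) = FreeGroup.map (Fin.cast h) := by
  subst h
  exact FreeGroup.ext_hom (MonoidHom.id _) _ fun _ => by simp

/-- Removes the transports in the strictness conditions: for functors that are the identity on
natural numbers, they run along definitional equalities. -/
theorem eqToHom_comp_comp_eqToHom_self {C : Type*} [Category C] {X Y : C} (f : X ⟶ Y)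
    (h : X = X) (h' : Y = Y) : eqToHom h ≫ f ≫ eqToHom h' = f := by
  simp

/-- The functor from the free category to free groups that evaluates terms. -/
def hopfEvalFunctor : StrictSymmetricFunctor hopfProp.Obj freeGroupProp.Obj where
  obj n := n
  map f := hopfEval f
  map_id _ := rfl
  map_comp f g := hopfEval_comp f g
  obj_unit := rfl
  obj_tensor _ _ := rfl
  map_tensor f g :=
    (hopfEval_tensor f g).trans (eqToHom_comp_comp_eqToHom_self (C := freeGroupProp.Obj) _ _ _).symm
  map_symmetry _ _ := (eqToHom_comp_comp_eqToHom_self (C := freeGroupProp.Obj) _ _ _).symm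

theorem hopfEvalFunctor_mapsHopf :
    hopfEvalFunctor.MapsHopf hopfProp.gen freeGroupProp.gen where
  obj_eq := rfl
  map_mul := (eqToHom_comp_comp_eqToHom_self (C := freeGroupProp.Obj) _ _ _).symm
  map_one := (eqToHom_comp_comp_eqToHom_self (C := freeGroupProp.Obj) _ _ _).symm
  map_comul := (eqToHom_comp_comp_eqToHom_self (C := freeGroupProp.Obj) _ _ _).symm
  map_counit := (eqToHom_comp_comp_eqToHom_self (C := freeGroupProp.Obj) _ _ _).symm
  map_antipode :=
    (eqToHom_comp_comp_eqToHom_self (X := freeGroupProp.gen) (Y := freeGroupProp.gen)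
      _ rfl rfl).symm

/-! ### Words in the coordinate morphisms -/

section Words

open HopfCoproduct
open scoped MonObj ComonObj HopfObj

/-- The monoid structure on the objects of the free category. -/
@[reducible]
def hopfMon (X : hopfProp.Obj) : MonObj X := hopfProp.powMon X

theorem hopfMon_gen : hopfMon hopfProp.gen = BimonObj.toMonObj := hopfProp.powMon_gen

theorem hopfMon_tensor (X Y : hopfProp.Obj) :
    hopfMon (X ⊗ Y) = monTensor (hopfMon X) (hopfMon Y) :=
  hopfProp.powMon_tensor X Y

attribute [local instance] hopfMon

theorem hopfMon_isMonHom {X Y : hopfProp.Obj} (f : X ⟶ Y) : IsMonHom f := hopfProp_isMonHom f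

attribute [local instance] hopfMon_isMonHom

theorem hopfProp_hom_ext {X Y Z : hopfProp.Obj} {f g : X ⊗ Y ⟶ Z}
    (h₁ : inl X Y ≫ f = inl X Y ≫ g) (h₂ : inr X Y ≫ f = inr X Y ≫ g) : f = g := by
  -- The coproduct argument needs the tensor product structure on `X ⊗ Y`, not the tensor power
  -- structure.
  have key (f : X ⊗ Y ⟶ Z) : @IsMonHom _ _ _ _ _ (monTensor (hopfMon X) (hopfMon Y)) _ f := by
    rw [← hopfMon_tensor]
    infer_instance
  have := key f
  have := key g
  exact tensor_hom_ext h₁ h₂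

/-- The unit object is initial: its monoid unit is the identity, and `f` preserves units. -/
theorem hopfMon_one_eq {X : hopfProp.Obj} (f : 𝟙_ hopfProp.Obj ⟶ X) : f = η[X] :=
  (Category.id_comp f).symm.trans (IsMonHom.one_hom f)

/-- The convolution group of morphisms from the generating Hopf monoid. -/
@[reducible]
def hopfConvGroup (X : hopfProp.Obj) : Group (hopfProp.gen ⟶ X) :=
  convGroup hopfProp.gen X fun f => hopfMon_gen ▸ hopfMon_isMonHom f

attribute [local instance] hopfConvGroup

/-- Composition with a fixed morphism, as a homomorphism of convolution groups. -/
def hopfPostcomp {X Y : hopfProp.Obj} (h : X ⟶ Y) : (hopfProp.gen ⟶ X) →* (hopfProp.gen ⟶ Y) :=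
  MonoidHom.mk' (· ≫ h) fun f g => conv_comp f g h

/-- The coordinate morphisms from the generating object to its powers. -/
def hopfCoord : (n : ℕ) → Fin n → (hopfProp.gen ⟶ hopfPow n)
  | 0 => Fin.elim0
  | n + 1 => Fin.lastCases (motive := fun _ => hopfProp.gen ⟶ hopfPow (n + 1))
      (inr (hopfPow n) hopfProp.gen) (fun i => hopfCoord n i ≫ inl (hopfPow n) hopfProp.gen)

theorem hopfCoord_last (n : ℕ) :
    hopfCoord (n + 1) (Fin.last n) = inr (hopfPow n) hopfProp.gen :=
  Fin.lastCases_last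

theorem hopfCoord_castSucc (n : ℕ) (i : Fin n) :
    hopfCoord (n + 1) i.castSucc = hopfCoord n i ≫ inl (hopfPow n) hopfProp.gen :=
  Fin.lastCases_castSucc _

/-- The morphism denoted by a word in the coordinates. -/
def hopfWord (n : ℕ) : FreeGroup (Fin n) →* (hopfProp.gen ⟶ hopfPow n) :=
  FreeGroup.lift (hopfCoord n)

theorem hopfWord_of (n : ℕ) (i : Fin n) : hopfWord n (FreeGroup.of i) = hopfCoord n i :=
  FreeGroup.lift_apply_of

theorem hopf_inl_inl_associator (X Y Z : hopfProp.Obj) :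
    inl X Y ≫ inl (X ⊗ Y) Z ≫ (α_ X Y Z).hom = inl X (Y ⊗ Z) := by
  rw [hopfMon_tensor]
  exact inl_inl_associator X Y Z

theorem hopf_inr_associator (X Y Z : hopfProp.Obj) :
    inr (X ⊗ Y) Z ≫ (α_ X Y Z).hom = inr Y Z ≫ inr X (Y ⊗ Z) := by
  rw [hopfMon_tensor]
  exact inr_associator X Y Z

/-- The coordinates are defined by splitting off the last factor; this and `hopfCoord_natAdd` allow
any splitting. -/
theorem hopfCoord_castAdd (m n : ℕ) (i : Fin m) :
    hopfCoord (m + n) (Fin.castAdd n i) = hopfCoord m i ≫ inl (hopfPow m) (hopfPow n) := by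
  induction n with
  | zero =>
    have h : η[hopfPow 0] = 𝟙 (𝟙_ hopfProp.Obj) := (hopfMon_one_eq _).symm
    have h' : inl (hopfPow m) (hopfPow 0) = (ρ_ (hopfPow m)).inv := by
      rw [inl, h]
      exact (congrArg _ (whiskerLeft_id _ _)).trans (Category.comp_id _)
    rw [h']
    exact (Category.comp_id _).symm
  | succ n ih =>
    refine (hopfCoord_castSucc (m + n) (Fin.castAdd n i)).trans ?_
    rw [ih]
    refine (Category.assoc _ _ _).trans ?_
    refine congrArg (hopfCoord m i ≫ ·) ?_
    refine Eq.trans ?_ (hopf_inl_inl_associator (hopfPow m) (hopfPow n) hopfProp.gen)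
    -- The associator of `m`, `n`, `1` is an identity by definition.
    exact congrArg (inl (hopfPow m) (hopfPow n) ≫ ·) (Category.comp_id _).symm

theorem hopfCoord_natAdd (m n : ℕ) (i : Fin n) :
    hopfCoord (m + n) (Fin.natAdd m i) = hopfCoord n i ≫ inr (hopfPow m) (hopfPow n) := by
  induction n with
  | zero => exact i.elim0
  | succ n ih =>
    induction i using Fin.lastCases with
    | last =>
      refine (hopfCoord_last (m + n)).trans ?_
      rw [hopfCoord_last]
      refine Eq.trans ?_ (hopf_inr_associator (hopfPow m) (hopfPow n) hopfProp.gen)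
      exact (Category.comp_id _).symm
    | cast i =>
      refine (hopfCoord_castSucc (m + n) (Fin.natAdd m i)).trans ?_
      rw [ih, hopfCoord_castSucc]
      refine (Category.assoc _ _ _).trans (Eq.trans ?_ (Category.assoc _ _ _).symm)
      refine congrArg (hopfCoord n i ≫ ·) ?_
      refine Eq.trans ?_ (inr_inl_associator (hopfPow m) (hopfPow n) hopfProp.gen)
      exact congrArg (inr (hopfPow m) (hopfPow n) ≫ ·) (Category.comp_id _).symm

theorem hopfWord_castAdd (m n : ℕ) (w : FreeGroup (Fin m)) :
    hopfWord (m + n) (FreeGroup.map (Fin.castAdd n) w) =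
      hopfWord m w ≫ inl (hopfPow m) (hopfPow n) := by
  have : (hopfWord (m + n)).comp (FreeGroup.map (Fin.castAdd n)) =
      (hopfPostcomp (inl (hopfPow m) (hopfPow n))).comp (hopfWord m) :=
    FreeGroup.ext_hom _ _ fun i => by
      simp only [MonoidHom.comp_apply, FreeGroup.map.of, hopfWord_of, hopfCoord_castAdd]
      exact (congrArg (· ≫ inl (hopfPow m) (hopfPow n)) (hopfWord_of m i)).symm
  exact DFunLike.congr_fun this w

theorem hopfWord_natAdd (m n : ℕ) (w : FreeGroup (Fin n)) :
    hopfWord (m + n) (FreeGroup.map (Fin.natAdd m) w) =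
      hopfWord n w ≫ inr (hopfPow m) (hopfPow n) := by
  have : (hopfWord (m + n)).comp (FreeGroup.map (Fin.natAdd m)) =
      (hopfPostcomp (inr (hopfPow m) (hopfPow n))).comp (hopfWord n) :=
    FreeGroup.ext_hom _ _ fun i => by
      simp only [MonoidHom.comp_apply, FreeGroup.map.of, hopfWord_of, hopfCoord_natAdd]
      exact (congrArg (· ≫ inr (hopfPow m) (hopfPow n)) (hopfWord_of n i)).symm
  exact DFunLike.congr_fun this w

theorem hopfCoord_one (i : Fin 1) : hopfCoord 1 i = 𝟙 hopfProp.gen := by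
  have h : η[hopfPow 0] = 𝟙 (𝟙_ hopfProp.Obj) := (hopfMon_one_eq _).symm
  rw [Subsingleton.elim i (Fin.last 0)]
  refine (hopfCoord_last 0).trans ?_
  rw [inr, h]
  refine (congrArg _ (id_whiskerRight _ _)).trans ((Category.comp_id _).trans ?_)
  rfl

theorem hopfCoord_two_zero : hopfCoord 2 0 = inl hopfProp.gen hopfProp.gen := by
  refine (hopfCoord_castAdd 1 1 0).trans ?_
  rw [hopfCoord_one]
  exact Category.id_comp _

theorem hopfCoord_two_one : hopfCoord 2 1 = inr hopfProp.gen hopfProp.gen :=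
  hopfCoord_last 1

/-- Words are compatible with the morphism `f` when the word of the image of a group element under
the homomorphism denoted by `f` is the composite of the word of that element with `f`. -/
def WordCompatible {m n : ℕ} (f : hopfPow m ⟶ hopfPow n) : Prop :=
  ∀ w, hopfWord n (hopfEval f w) = hopfWord m w ≫ f

/-- Both sides are homomorphisms in `w`, the right one because postcomposition preserves
convolution, so free generators suffice. -/
theorem wordCompatible_of_coord {m n : ℕ} {f : hopfPow m ⟶ hopfPow n}
    (h : ∀ i, hopfWord n (hopfEval f (FreeGroup.of i)) = hopfCoord m i ≫ f) :
    WordCompatible f := by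
  have : (hopfWord n).comp (hopfEval f) = (hopfPostcomp f).comp (hopfWord m) :=
    FreeGroup.ext_hom _ _ fun i =>
      (h i).trans (congrArg (· ≫ f) (hopfWord_of m i)).symm
  exact DFunLike.congr_fun this

theorem wordCompatible_comp {l m n : ℕ} {f : hopfPow l ⟶ hopfPow m} {g : hopfPow m ⟶ hopfPow n}
    (hf : WordCompatible f) (hg : WordCompatible g) : WordCompatible (f ≫ g) := fun w => by
  rw [hopfEval_comp, MonoidHom.comp_apply, hg, hf, Category.assoc]

theorem wordCompatible_tensor {m n m' n' : ℕ} {f : hopfPow m ⟶ hopfPow n}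
    {g : hopfPow m' ⟶ hopfPow n'} (hf : WordCompatible f) (hg : WordCompatible g) :
    WordCompatible (m := m + m') (n := n + n') (f ⊗ₘ g) := by
  refine wordCompatible_of_coord fun i => ?_
  rw [hopfEval_tensor]
  refine Fin.addCases (fun i => ?_) (fun i => ?_) i
  · rw [← FreeGroup.map.of, freeGroupTensor_castAdd, hopfWord_castAdd, hf, hopfWord_of,
      hopfCoord_castAdd]
    refine (Category.assoc _ _ _).trans (Eq.trans ?_ (Category.assoc _ _ _).symm)
    exact congrArg (hopfCoord m i ≫ ·) (inl_tensorHom f g).symm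
  · rw [← FreeGroup.map.of, freeGroupTensor_natAdd, hopfWord_natAdd, hg, hopfWord_of,
      hopfCoord_natAdd]
    refine (Category.assoc _ _ _).trans (Eq.trans ?_ (Category.assoc _ _ _).symm)
    exact congrArg (hopfCoord m' i ≫ ·) (inr_tensorHom f g).symm

theorem wordCompatible_braiding (m n : ℕ) :
    WordCompatible (m := m + n) (n := n + m) (β_ (hopfPow m) (hopfPow n)).hom := by
  refine wordCompatible_of_coord fun i => ?_
  change hopfWord (n + m) (freeGroupSwap m n _) = _
  refine Fin.addCases (fun i => ?_) (fun i => ?_) i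
  · rw [← FreeGroup.map.of, freeGroupSwap_castAdd, FreeGroup.map.of, hopfWord_of,
      hopfCoord_castAdd, hopfCoord_natAdd]
    refine Eq.trans ?_ (Category.assoc _ _ _).symm
    exact congrArg (hopfCoord m i ≫ ·) (inl_braiding (hopfPow m) (hopfPow n)).symm
  · rw [← FreeGroup.map.of, freeGroupSwap_natAdd, FreeGroup.map.of, hopfWord_of,
      hopfCoord_castAdd, hopfCoord_natAdd]
    refine Eq.trans ?_ (Category.assoc _ _ _).symm
    exact congrArg (hopfCoord n i ≫ ·) (inr_braiding (hopfPow m) (hopfPow n)).symm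

theorem wordCompatible_mul : WordCompatible (m := 2) (n := 1) hopfPropHopf.mul := by
  refine wordCompatible_of_coord fun i => ?_
  have h : hopfEval (m := 2) (n := 1) hopfPropHopf.mul (FreeGroup.of i) = FreeGroup.of 0 := by
    fin_cases i <;> rfl
  rw [h, hopfWord_of, hopfCoord_one]
  fin_cases i
  · refine Eq.symm ((congrArg (· ≫ _) hopfCoord_two_zero).trans ?_)
    change inl hopfProp.gen hopfProp.gen ≫ @MonObj.mul _ _ _ hopfProp.gen BimonObj.toMonObj = _
    rw [hopfMon_gen, inl]
    simp
  · refine Eq.symm ((congrArg (· ≫ _) hopfCoord_two_one).trans ?_)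
    change inr hopfProp.gen hopfProp.gen ≫ @MonObj.mul _ _ _ hopfProp.gen BimonObj.toMonObj = _
    rw [hopfMon_gen, inr]
    simp

/-- The word `x₁ x₂` denotes the convolution of the two coprojections, which is `Δ ≫ desc inl inr =
Δ`. -/
theorem wordCompatible_comul : WordCompatible (m := 1) (n := 2) hopfPropHopf.comul := by
  refine wordCompatible_of_coord fun i => ?_
  have h : hopfEval (m := 1) (n := 2) hopfPropHopf.comul (FreeGroup.of i) =
      FreeGroup.of 0 * FreeGroup.of 1 := by
    fin_cases i; rfl
  rw [h, map_mul, hopfWord_of, hopfWord_of, hopfCoord_one, hopfCoord_two_zero, hopfCoord_two_one]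
  refine Eq.trans ?_ ((Category.comp_id _).trans (Category.id_comp _).symm)
  change Δ[hopfProp.gen] ≫ @desc _ _ _ _ _ _ (hopfMon (hopfProp.gen ⊗ hopfProp.gen))
    (inl hopfProp.gen hopfProp.gen) (inr hopfProp.gen hopfProp.gen) =
      Δ[hopfProp.gen] ≫ 𝟙 (hopfProp.gen ⊗ hopfProp.gen)
  rw [hopfMon_tensor, desc_inl_inr]

theorem wordCompatible_counit : WordCompatible (m := 1) (n := 0) hopfPropHopf.counit := by
  refine wordCompatible_of_coord fun i => ?_
  have h : hopfEval (m := 1) (n := 0) hopfPropHopf.counit (FreeGroup.of i) = 1 :=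
    Subsingleton.elim _ _
  rw [h, map_one, hopfCoord_one]
  refine Eq.trans ?_ ((Category.comp_id _).trans (Category.id_comp _).symm)
  exact congrArg (ε[hopfProp.gen] ≫ ·) (hopfMon_one_eq _).symm

theorem wordCompatible_antipode : WordCompatible (m := 1) (n := 1) hopfPropHopf.antipode := by
  refine wordCompatible_of_coord fun i => ?_
  have h : hopfEval (m := 1) (n := 1) hopfPropHopf.antipode (FreeGroup.of i) =
      (FreeGroup.of 0)⁻¹ := by
    fin_cases i; rfl
  rw [h, map_inv, hopfWord_of, hopfCoord_one, hopfCoord_one]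
  exact (Category.comp_id _).trans (Category.id_comp _).symm

theorem wordCompatible_term {m n : ℕ} (t : HopfTerm m n) :
    WordCompatible (m := m) (n := n) (Quotient.mk (HopfTerm.setoid m n) t) := by
  induction t with
  | id n => exact fun w => (Category.comp_id (hopfWord n w)).symm
  | comp f g ihf ihg => exact wordCompatible_comp ihf ihg
  | tensor f g ihf ihg => exact wordCompatible_tensor ihf ihg
  | swap m n => exact wordCompatible_braiding m n
  | mul => exact wordCompatible_mul
  | one => exact wordCompatible_of_coord fun i => i.elim0
  | comul => exact wordCompatible_comul
  | counit => exact wordCompatible_counit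
  | antipode => exact wordCompatible_antipode

theorem hopfWord_eval {m n : ℕ} (f : hopfPow m ⟶ hopfPow n) (w : FreeGroup (Fin m)) :
    hopfWord n (hopfEval f w) = hopfWord m w ≫ f := by
  induction f using Quotient.inductionOn with | h t => exact wordCompatible_term t w

end Words

/-! ### Evaluation is bijective on morphisms -/

section Bijectivity

open HopfCoproduct
open scoped MonObj ComonObj HopfObj

attribute [local instance] hopfMon hopfMon_isMonHom hopfConvGroup

theorem hopfPow_hom_ext {m n : ℕ} {f g : hopfPow m ⟶ hopfPow n}
    (h : ∀ i, hopfCoord m i ≫ f = hopfCoord m i ≫ g) : f = g := by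
  induction m with
  | zero => exact (hopfMon_one_eq f).trans (hopfMon_one_eq g).symm
  | succ m ih =>
    refine hopfProp_hom_ext (X := hopfPow m) (Y := hopfProp.gen) (ih fun i => ?_) ?_
    · have := h i.castSucc
      rw [hopfCoord_castSucc] at this
      exact (Category.assoc _ _ _).symm.trans (this.trans (Category.assoc _ _ _))
    · have := h (Fin.last m)
      rwa [hopfCoord_last] at this

theorem hopfPow_exists_desc {m n : ℕ} (a : Fin m → (hopfProp.gen ⟶ hopfPow n)) :
    ∃ f : hopfPow m ⟶ hopfPow n, ∀ i, hopfCoord m i ≫ f = a i := by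
  induction m with
  | zero => exact ⟨η[hopfPow n], fun i => i.elim0⟩
  | succ m ih =>
    obtain ⟨f, hf⟩ := ih fun i => a i.castSucc
    refine ⟨desc (X := hopfPow m) (Y := hopfProp.gen) f (a (Fin.last m)), fun i => ?_⟩
    induction i using Fin.lastCases with
    | last =>
      rw [hopfCoord_last]
      exact inr_desc _ _
    | cast i =>
      rw [hopfCoord_castSucc, ← hf]
      exact (Category.assoc _ _ _).trans (congrArg (hopfCoord m i ≫ ·) (inl_desc _ _))

theorem hopfEval_inl (m n : ℕ) :
    hopfEval (m := m) (n := m + n) (inl (hopfPow m) (hopfPow n)) =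
      FreeGroup.map (Fin.castAdd n) := by
  have h : inl (hopfPow m) (hopfPow n) =
      (ρ_ (hopfPow m)).inv ≫ (𝟙 (hopfPow m) ⊗ₘ η[hopfPow n]) := by
    rw [id_tensorHom]; rfl
  rw [h]
  refine (hopfEval_comp (m := m + 0) _ _).trans ?_
  refine FreeGroup.ext_hom _ _ fun i => ?_
  refine (DFunLike.congr_fun (hopfEval_tensor (m := m) (n := m) (m' := 0) (n' := n)
    (𝟙 (hopfPow m)) η[hopfPow n]) (FreeGroup.of (Fin.castAdd 0 i))).trans ?_
  rw [← FreeGroup.map.of, freeGroupTensor_castAdd]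
  rfl

theorem hopfEval_inr (m n : ℕ) :
    hopfEval (m := n) (n := m + n) (inr (hopfPow m) (hopfPow n)) =
      FreeGroup.map (Fin.natAdd m) := by
  have h : inr (hopfPow m) (hopfPow n) =
      (λ_ (hopfPow n)).inv ≫ (η[hopfPow m] ⊗ₘ 𝟙 (hopfPow n)) := by
    rw [tensorHom_id]; rfl
  rw [h]
  refine (hopfEval_comp (m := 0 + n) _ _).trans ?_
  refine FreeGroup.ext_hom _ _ fun i => ?_
  -- Unlike `m + 0 = m`, the equality `0 + n = n` is not definitional, so the left unitor must be
  -- evaluated as a relabelling.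
  have h' : hopfEval (m := n) (n := 0 + n) (λ_ (hopfPow n)).inv (FreeGroup.of i) =
      FreeGroup.map (Fin.natAdd 0) (FreeGroup.of i) := by
    refine (DFunLike.congr_fun (hopfEval_eqToHom (Nat.zero_add n).symm) _).trans ?_
    rw [FreeGroup.map.of, FreeGroup.map.of]
    exact congrArg _ (Fin.ext (Nat.zero_add i).symm)
  rw [MonoidHom.comp_apply, h']
  refine (DFunLike.congr_fun (hopfEval_tensor (m := 0) (n := m) (m' := n) (n' := n)
    η[hopfPow m] (𝟙 (hopfPow n))) _).trans ?_
  rw [freeGroupTensor_natAdd]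
  rfl

theorem hopfEval_coord (n : ℕ) (i : Fin n) :
    hopfEval (m := 1) (hopfCoord n i) (FreeGroup.of 0) = FreeGroup.of i := by
  induction n with
  | zero => exact i.elim0
  | succ n ih =>
    induction i using Fin.lastCases with
    | last =>
      rw [hopfCoord_last]
      exact DFunLike.congr_fun (hopfEval_inr n 1) (FreeGroup.of 0)
    | cast i =>
      rw [hopfCoord_castSucc]
      refine (DFunLike.congr_fun (hopfEval_comp (l := 1) (m := n) (n := n + 1) _ _)
        (FreeGroup.of 0)).trans ?_
      rw [MonoidHom.comp_apply, ih]
      exact DFunLike.congr_fun (hopfEval_inl n 1) (FreeGroup.of i)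

/-- `f * g` is `Δ ≫ desc f g`, and `Δ` evaluates to `x₁ ↦ x₁ x₂`; the two factors restrict `desc f
g` to `f` and `g`. -/
theorem hopfEval_conv {n : ℕ} (f g : hopfProp.gen ⟶ hopfPow n) :
    hopfEval (m := 1) (f * g) (FreeGroup.of 0) =
      hopfEval (m := 1) f (FreeGroup.of 0) * hopfEval (m := 1) g (FreeGroup.of 0) := by
  let d : hopfPow 2 ⟶ hopfPow n := desc f g
  have h₁ : hopfEval d (FreeGroup.of 0) = hopfEval (m := 1) f (FreeGroup.of 0) := by
    conv_rhs => rw [← inl_desc f g]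
    refine Eq.symm ((DFunLike.congr_fun (hopfEval_comp (l := 1) (m := 2) (n := n) _ d) _).trans ?_)
    exact congrArg (hopfEval d) (DFunLike.congr_fun (hopfEval_inl 1 1) (FreeGroup.of 0))
  have h₂ : hopfEval d (FreeGroup.of 1) = hopfEval (m := 1) g (FreeGroup.of 0) := by
    conv_rhs => rw [← inr_desc f g]
    refine Eq.symm ((DFunLike.congr_fun (hopfEval_comp (l := 1) (m := 2) (n := n) _ d) _).trans ?_)
    exact congrArg (hopfEval d) (DFunLike.congr_fun (hopfEval_inr 1 1) (FreeGroup.of 0))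
  rw [← h₁, ← h₂, ← map_mul]
  exact DFunLike.congr_fun (hopfEval_comp (l := 1) (m := 2) (n := n) hopfPropHopf.comul d)
    (FreeGroup.of 0)

/-- By `hopfEval_conv` this composite is an endomorphism of the free group, and it fixes the
generators. -/
theorem hopfEval_word {n : ℕ} (w : FreeGroup (Fin n)) :
    hopfEval (m := 1) (hopfWord n w) (FreeGroup.of 0) = w := by
  have : (MonoidHom.mk' (fun f : hopfProp.gen ⟶ hopfPow n =>
      hopfEval (m := 1) f (FreeGroup.of 0)) hopfEval_conv).comp (hopfWord n) = MonoidHom.id _ :=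
    FreeGroup.ext_hom _ _ fun i => by
      refine Eq.trans ?_ (hopfEval_coord n i)
      exact congrArg (fun f => hopfEval (m := 1) f (FreeGroup.of 0)) (hopfWord_of n i)
  exact DFunLike.congr_fun this w

theorem hopfEval_injective (m n : ℕ) : Function.Injective (hopfEval (m := m) (n := n)) :=
  fun f g h => hopfPow_hom_ext fun i => by
    rw [← hopfWord_of, ← hopfWord_eval, ← hopfWord_eval, h]

theorem hopfEval_surjective (m n : ℕ) : Function.Surjective (hopfEval (m := m) (n := n)) := by
  intro g
  -- The preimage has as components the words of the images of the generators.
  obtain ⟨f, hf⟩ := hopfPow_exists_desc fun i => hopfWord n (g (FreeGroup.of i))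
  refine ⟨f, FreeGroup.ext_hom _ _ fun i => ?_⟩
  have h := congrArg (fun k => hopfEval (m := 1) k (FreeGroup.of 0)) (hf i)
  simp only [hopfEval_word] at h
  rw [← h]
  refine Eq.symm ((DFunLike.congr_fun (hopfEval_comp (l := 1) (m := m) (n := n) _ f) _).trans ?_)
  exact congrArg (hopfEval f) (hopfEval_coord m i)

end Bijectivity

/-! ### The inverse functor -/

/-- The bijection between classes of terms and homomorphisms of free groups. -/
noncomputable def hopfEvalEquiv (m n : ℕ) :
    (hopfPow m ⟶ hopfPow n) ≃ (FreeGroup (Fin m) →* FreeGroup (Fin n)) :=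
  Equiv.ofBijective hopfEval ⟨hopfEval_injective m n, hopfEval_surjective m n⟩

theorem hopfEval_equiv_symm {m n : ℕ} (g : FreeGroup (Fin m) →* FreeGroup (Fin n)) :
    hopfEval ((hopfEvalEquiv m n).symm g) = g :=
  (hopfEvalEquiv m n).apply_symm_apply g

/-- The inverse of the evaluation functor. -/
noncomputable def hopfEvalInverse : StrictSymmetricFunctor freeGroupProp.Obj hopfProp.Obj where
  obj n := n
  map {m n} f := (hopfEvalEquiv m n).symm f
  map_id n := hopfEval_injective n n (hopfEval_equiv_symm _)
  map_comp {l m n} f g := hopfEval_injective l n <| by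
    refine (hopfEval_equiv_symm _).trans (Eq.symm ((hopfEval_comp _ _).trans ?_))
    exact congrArg₂ MonoidHom.comp (hopfEval_equiv_symm g) (hopfEval_equiv_symm f)
  obj_unit := rfl
  obj_tensor _ _ := rfl
  map_tensor {X Y X' Y'} f g := by
    refine Eq.trans ?_ (eqToHom_comp_comp_eqToHom_self (C := hopfProp.Obj) _ _ _).symm
    refine hopfEval_injective _ _ ((hopfEval_equiv_symm _).trans (Eq.symm ?_))
    refine (hopfEval_tensor _ _).trans ?_
    exact congrArg₂ freeGroupTensor (hopfEval_equiv_symm f) (hopfEval_equiv_symm g)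
  map_symmetry X Y := by
    refine Eq.trans ?_ (eqToHom_comp_comp_eqToHom_self (C := hopfProp.Obj) _ _ _).symm
    exact hopfEval_injective _ _ (hopfEval_equiv_symm _)

theorem hopfEvalFunctor_isIsomorphism : hopfEvalFunctor.IsIsomorphism :=
  ⟨hopfEvalInverse,
    Functor.hext (fun _ => rfl) fun m n f => heq_of_eq ((hopfEvalEquiv m n).symm_apply_apply f),
    Functor.hext (fun _ => rfl) fun m n f => heq_of_eq ((hopfEvalEquiv m n).apply_symm_apply f)⟩

/-! ### Uniqueness of the functor -/

namespace StrictProp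

variable {P : StrictProp}

/-- For an arbitrary functor `T`, the equality `T.obj n = n` is only provable, so transports must be
moved through tensor products and symmetries. -/
theorem tensorHom_eqToHom_conj {A B A' B' X Y X' Y' : P.Obj} (hA : A = X) (hB : Y = B)
    (hA' : A' = X') (hB' : Y' = B') (f : X ⟶ Y) (g : X' ⟶ Y') :
    (eqToHom hA ≫ f ≫ eqToHom hB) ⊗ₘ (eqToHom hA' ≫ g ≫ eqToHom hB') =
      eqToHom (congrArg₂ (· ⊗ ·) hA hA') ≫ (f ⊗ₘ g) ≫ eqToHom (congrArg₂ (· ⊗ ·) hB hB') := by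
  subst hA hB hA' hB'
  simp

theorem braiding_eqToHom_conj {A B X Y : P.Obj} (hA : A = X) (hB : B = Y) :
    (β_ A B).hom = eqToHom (congrArg₂ (· ⊗ ·) hA hB) ≫ (β_ X Y).hom ≫
      eqToHom (congrArg₂ (· ⊗ ·) hB hA).symm := by
  subst hA hB
  simp

end StrictProp

theorem StrictSymmetricFunctor.ext_of_toFunctor {C D : Type*}
    [Category C] [MonoidalCategory C] [SymmetricCategory C] [StrictMonoidal C]
    [Category D] [MonoidalCategory D] [SymmetricCategory D] [StrictMonoidal D]
    {T T' : StrictSymmetricFunctor C D} (h : T.toFunctor = T'.toFunctor) : T = T' := by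
  cases T; cases T'; cases h; rfl

section Uniqueness

variable {T : StrictSymmetricFunctor hopfProp.Obj freeGroupProp.Obj}

theorem StrictSymmetricFunctor.MapsHopf.obj_eq_self (hT : T.MapsHopf hopfProp.gen freeGroupProp.gen)
    (n : ℕ) : T.obj (hopfPow n) = hopfEvalFunctor.obj (hopfPow n) := by
  induction n with
  | zero => exact T.obj_unit
  | succ n ih =>
    exact (T.obj_tensor (hopfPow n) hopfProp.gen).trans (congrArg₂ (· ⊗ ·) ih hT.obj_eq)

/-- Strictness settles composites, tensor products and symmetries, and `MapsHopf` settles the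
generators. The variable `f` keeps the class of `t` typed as a morphism of the category. -/
theorem StrictSymmetricFunctor.MapsHopf.map_term (hT : T.MapsHopf hopfProp.gen freeGroupProp.gen)
    {m n : ℕ} (t : HopfTerm m n) (f : hopfPow m ⟶ hopfPow n)
    (hf : f = Quotient.mk (HopfTerm.setoid m n) t) :
    T.map f = eqToHom (hT.obj_eq_self m) ≫ hopfEvalFunctor.map f ≫
      eqToHom (hT.obj_eq_self n).symm := by
  induction t with
  | id n =>
    have : f = 𝟙 (hopfPow n) := hf
    rw [this]
    simp
  | @comp l m n t u iht ihu =>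
    have : f = (show hopfPow l ⟶ hopfPow m from Quotient.mk (HopfTerm.setoid l m) t) ≫
      (show hopfPow m ⟶ hopfPow n from Quotient.mk (HopfTerm.setoid m n) u) := hf
    rw [this, Functor.map_comp, Functor.map_comp, iht _ rfl, ihu _ rfl]
    simp
  | @tensor m n m' n' t u iht ihu =>
    obtain rfl : f = (show hopfPow m ⟶ hopfPow n from Quotient.mk (HopfTerm.setoid m n) t) ⊗ₘ
      (show hopfPow m' ⟶ hopfPow n' from Quotient.mk (HopfTerm.setoid m' n') u) := hf
    refine (T.map_tensor _ _).trans ?_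
    rw [iht _ rfl, ihu _ rfl, StrictProp.tensorHom_eqToHom_conj]
    simp only [Category.assoc, eqToHom_trans, eqToHom_trans_assoc]
    rfl
  | swap m n =>
    obtain rfl : f = (β_ (hopfPow m) (hopfPow n)).hom := hf
    refine (T.map_symmetry _ _).trans ?_
    rw [StrictProp.braiding_eqToHom_conj (hT.obj_eq_self m) (hT.obj_eq_self n)]
    simp only [Category.assoc, eqToHom_trans, eqToHom_trans_assoc]
    rfl
  | mul => subst hf; exact hT.map_mul
  | one => subst hf; exact hT.map_one
  | comul => subst hf; exact hT.map_comul
  | counit => subst hf; exact hT.map_counit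
  | antipode => subst hf; exact hT.map_antipode

theorem StrictSymmetricFunctor.MapsHopf.eq_hopfEvalFunctor
    (hT : T.MapsHopf hopfProp.gen freeGroupProp.gen) : T = hopfEvalFunctor :=
  ext_of_toFunctor <| CategoryTheory.Functor.ext hT.obj_eq_self fun m n f => by
    obtain ⟨t, ht⟩ := Quotient.exists_rep f
    exact hT.map_term (m := m) (n := n) t f ht.symm

end Uniqueness

theorem theorem4p1 :
    ∃ T : StrictSymmetricFunctor hopfProp.Obj freeGroupProp.Obj,
      T.MapsHopf hopfProp.gen freeGroupProp.gen ∧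
      (∀ T' : StrictSymmetricFunctor hopfProp.Obj freeGroupProp.Obj,
        T'.MapsHopf hopfProp.gen freeGroupProp.gen → T' = T) ∧
      T.IsIsomorphism :=
  ⟨hopfEvalFunctor, hopfEvalFunctor_mapsHopf, fun _ hT => hT.eq_hopfEvalFunctor,
    hopfEvalFunctor_isIsomorphism⟩
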